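/- Let $n\ge 0$ and let $\mathfrak g=\mathfrak{gl}_{2n+1}(\mathbb C)$, with matrix units $E_{p,q}$; write $E_k=E_{k,k+1}$, $F_k=E_{k+1,k}$ $(1\le k\le 2n)$ and $H_k=E_{k,k}$ $(1\le k\le 2n+1)$. Let $\theta$ be the Lie algebra automorphism of $\mathfrak g$ with $\theta(E_k)=F_{2n+1-k}$, $\theta(F_k)=E_{2n+1-k}$, $\theta(H_k)=H_{2n+2-k}$, i.e. $\theta(E_{p,q})=E_{2n+2-p,\,2n+2-q}$. Let $\mathfrak g^\theta=\{x\in\mathfrak g: \theta(x)=x\}$, and let $U(\mathfrak g^\theta)$ be its universal enveloping algebra. Consider the following elements of $\mathfrak g^\theta$: $$\mathbf e_i=E_i+F_{2n+1-i},\quad \mathbf f_i=F_i+E_{2n+1-i}\quad(1\le i\le n),$$ $$\mathbf d_i=H_i+H_{2n+2-i}\quad(1\le i\le n),\qquad \mathbf d_{n+1}=2H_{n+1}.$$ Then the unital associative $\mathbb C$-algebra $U(\mathfrak g^\theta)$ is generated by $\mathbf e_1,\dots,\mathbf e_n$, $\mathbf f_1,\dots,\mathbf f_n$, $\mathbf d_1,\dots,\mathbf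 d_{n+1}$, and the following is a complete set of defining relations among these generators (with $1\le i,j\le n$ in relations among the $\mathbf e$'s and $\mathbf f$'s, and $1\le a,b\le n+1$, $1\le j\le n$ in those involving $\mathbf d_a$): \begin{align*} \mathbf d_a\mathbf d_b&=\mathbf d_b\mathbf d_a,\\ [\mathbf d_a,\mathbf e_j]&=(-\delta_{a,j+1}-\delta_{2n+2-a,j+1}+\delta_{a,j})\,\mathbf e_j,\\ [\mathbf d_a,\mathbf f_j]&=(-\delta_{a,j}+\delta_{a,j+1}+\delta_{2n+2-a,j+1})\,\mathbf f_j,\\ \mathbf e_i\mathbf f_j-\mathbf f_j\mathbf e_i&=\delta_{ij}(\mathbf d_i-\mathbf d_{i+1}) && (i,j)\ne(n,n),\\ \mathbf e_i^2\mathbf e_j-2\mathbf e_i\mathbf e_j\mathbf e_i+\mathbf e_j\mathbf e_i^2&=0 && |i-j|=1,\\ \mathbf f_i^2\mathbf f_j-2\mathbf f_i\mathbf f_j\mathbf f_i+\mathbf f_j\mathbf f_i^2&=0 && |i-j|=1,\\ \mathbf e_i\mathbf e_j&=\mathbf e_j\mathbf e_i && |i-j|>1,\\ \mathbf f_i\mathbf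 f_j&=\mathbf f_j\mathbf f_i && |i-j|>1,\\ \mathbf e_n^2\mathbf f_n-2\mathbf e_n\mathbf f_n\mathbf e_n+\mathbf f_n\mathbf e_n^2&=-4\mathbf e_n && (n\ge1),\\ \mathbf f_n^2\mathbf e_n-2\mathbf f_n\mathbf e_n\mathbf f_n+\mathbf e_n\mathbf f_n^2&=-4\mathbf f_n && (n\ge1). \end{align*} In other words, the algebra presented by symbols $e_i,f_i,d_a$ with these relations is isomorphic to $U(\mathfrak g^\theta)$ via $e_i\mapsto\mathbf e_i$, $f_i\mapsto\mathbf f_i$, $d_a\mapsto\mathbf d_a$. -/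

import Mathlib

noncomputable section

namespace FixedPointGL

attribute [local instance 100] LieRing.ofAssociativeRing

/-- The general linear Lie algebra `𝔤 = 𝔤𝔩_{2n+1}(ℂ)`, with the commutator bracket. -/
abbrev MatLie (n : ℕ) : Type := Matrix (Fin (2 * n + 1)) (Fin (2 * n + 1)) ℂ

/- Indices: an element `i : Fin m` stands for the index `i.val + 1 ∈ {1, …, m}`. -/

/-- `E_k`, the matrix unit in position `(k, k + 1)`, for `1 ≤ k ≤ 2n`. -/
def E (n : ℕ) (k : Fin (2 * n)) : MatLie n := Matrix.single k.castSucc k.succ 1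

/-- `F_k`, the matrix unit in position `(k + 1, k)`, for `1 ≤ k ≤ 2n`. -/
def F (n : ℕ) (k : Fin (2 * n)) : MatLie n := Matrix.single k.succ k.castSucc 1

/-- `H_k`, the matrix unit in position `(k, k)`, for `1 ≤ k ≤ 2n + 1`. -/
def H (n : ℕ) (k : Fin (2 * n + 1)) : MatLie n := Matrix.single k k 1

/-- The diagram automorphism `τ(k) = 2n + 1 - k` of the Dynkin diagram `{1, …, 2n}`. -/
def tau (n : ℕ) (k : Fin (2 * n)) : Fin (2 * n) := k.rev

/-- The automorphism `θ` of the Lie algebra `𝔤𝔩_{2n+1}(ℂ)`: it reverses the order of the rows and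
of the columns, so that it sends the matrix unit in position `(p, q)` to the one in position
`(2n + 2 - p, 2n + 2 - q)`. The three lemmas below compute it on `E_k`, `F_k`, `H_k`; as these
generate `𝔤`, the three formulas determine `θ`. -/
def theta (n : ℕ) : MatLie n ≃ₗ⁅ℂ⁆ MatLie n := Matrix.reindexLieEquiv Fin.revPerm

theorem theta_single (n : ℕ) (p q : Fin (2 * n + 1)) :
    theta n (Matrix.single p q 1) = Matrix.single p.rev q.rev 1 := by
  ext a b
  simp [theta, Matrix.single_apply, ← Fin.rev_eq_iff]

theorem theta_E (n : ℕ) (k : Fin (2 * n)) : theta n (E n k) = F n (tau n k) := by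
  simp [E, F, tau, theta_single, Fin.rev_castSucc, Fin.rev_succ]

theorem theta_F (n : ℕ) (k : Fin (2 * n)) : theta n (F n k) = E n (tau n k) := by
  simp [E, F, tau, theta_single, Fin.rev_castSucc, Fin.rev_succ]

/-- `θ(H_k) = H_{2n + 2 - k}`. -/
theorem theta_H (n : ℕ) (k : Fin (2 * n + 1)) : theta n (H n k) = H n k.rev := by
  simp [H, theta_single]

/-- The fixed-point Lie subalgebra `𝔤^θ = {x ∈ 𝔤 | θ(x) = x}`. -/
def fixedSubalgebra (n : ℕ) : LieSubalgebra ℂ (MatLie n) where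
  carrier := {x | theta n x = x}
  add_mem' {x y} hx hy := by
    change theta n x = x at hx
    change theta n y = y at hy
    change theta n (x + y) = x + y
    rw [map_add, hx, hy]
  zero_mem' := map_zero _
  smul_mem' c x hx := by
    change theta n x = x at hx
    change theta n (c • x) = c • x
    rw [map_smul, hx]
  lie_mem' {x y} hx hy := by
    change theta n x = x at hx
    change theta n y = y at hy
    change theta n ⁅x, y⁆ = ⁅x, y⁆
    rw [LieEquiv.map_lie, hx, hy]

/-- The vertex `i ∈ {1, …, n}`, as an element of `{1, …, 2n}`. -/
def vtx (n : ℕ) (i : Fin n) : Fin (2 * n) := Fin.castLE (by omega) i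

/-- The index `a ∈ {1, …, n + 1}`, as an element of `{1, …, 2n + 1}`. -/
def idx (n : ℕ) (a : Fin (n + 1)) : Fin (2 * n + 1) := Fin.castLE (by omega) a

/-- `𝐞_i = E_i + F_{2n + 1 - i}` in `𝔤^θ`, for `1 ≤ i ≤ n`. -/
def eFix (n : ℕ) (i : Fin n) : fixedSubalgebra n :=
  ⟨E n (vtx n i) + F n (tau n (vtx n i)), by
    change theta n _ = _
    rw [map_add, theta_E, theta_F, add_comm]
    simp [tau]⟩

/-- `𝐟_i = F_i + E_{2n + 1 - i}` in `𝔤^θ`, for `1 ≤ i ≤ n`. -/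
def fFix (n : ℕ) (i : Fin n) : fixedSubalgebra n :=
  ⟨F n (vtx n i) + E n (tau n (vtx n i)), by
    change theta n _ = _
    rw [map_add, theta_E, theta_F, add_comm]
    simp [tau]⟩

/-- `𝐝_a = H_a + H_{2n + 2 - a}` in `𝔤^θ`, for `1 ≤ a ≤ n + 1`; in particular
`𝐝_{n + 1} = 2 H_{n + 1}`, see `dFix_last`. -/
def dFix (n : ℕ) (a : Fin (n + 1)) : fixedSubalgebra n :=
  ⟨H n (idx n a) + H n (idx n a).rev, by
    change theta n _ = _
    rw [map_add, theta_H, theta_H, add_comm, Fin.rev_rev]⟩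

theorem dFix_last (n : ℕ) :
    (dFix n (Fin.last n) : MatLie n) = (2 : ℂ) • H n (idx n (Fin.last n)) := by
  have h : (idx n (Fin.last n)).rev = idx n (Fin.last n) := by
    ext
    simp [idx, Fin.val_rev]
    omega
  change H n (idx n (Fin.last n)) + H n (idx n (Fin.last n)).rev = _
  rw [h, two_smul]

/-- `U^j = U(𝔤^θ)`, the universal enveloping algebra of the fixed-point subalgebra. -/
abbrev Uj (n : ℕ) : Type := UniversalEnvelopingAlgebra ℂ (fixedSubalgebra n)

/-- The symbols `e_1, …, e_n, f_1, …, f_n, d_1, …, d_{n + 1}`. -/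
inductive Gen (n : ℕ) : Type
  | e (i : Fin n) : Gen n
  | f (i : Fin n) : Gen n
  | d (a : Fin (n + 1)) : Gen n

/-- The elements of `U(𝔤^θ)` named by the symbols. -/
def genVal (n : ℕ) : Gen n → Uj n
  | .e i => UniversalEnvelopingAlgebra.ι ℂ (eFix n i)
  | .f i => UniversalEnvelopingAlgebra.ι ℂ (fFix n i)
  | .d a => UniversalEnvelopingAlgebra.ι ℂ (dFix n a)

/-- The Kronecker delta. -/
def delta (p q : ℕ) : ℂ := if p = q then 1 else 0

/-- The symbols as elements of the free algebra on them. -/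
abbrev eF (n : ℕ) (i : Fin n) : FreeAlgebra ℂ (Gen n) := FreeAlgebra.ι ℂ (Gen.e i)
abbrev fF (n : ℕ) (i : Fin n) : FreeAlgebra ℂ (Gen n) := FreeAlgebra.ι ℂ (Gen.f i)
abbrev dF (n : ℕ) (a : Fin (n + 1)) : FreeAlgebra ℂ (Gen n) := FreeAlgebra.ι ℂ (Gen.d a)

/-- The defining relations. The index named by `i : Fin m` is `i.val + 1`, which is what the
Kronecker deltas are applied to. -/
inductive Rel (n : ℕ) : FreeAlgebra ℂ (Gen n) → FreeAlgebra ℂ (Gen n) → Prop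
  | dd (a b : Fin (n + 1)) : Rel n (dF n a * dF n b) (dF n b * dF n a)
  | de (a : Fin (n + 1)) (j : Fin n) :
      Rel n (dF n a * eF n j - eF n j * dF n a)
        ((-delta (a.val + 1) ((j.val + 1) + 1)
            - delta (2 * n + 2 - (a.val + 1)) ((j.val + 1) + 1)
            + delta (a.val + 1) (j.val + 1)) • eF n j)
  | df (a : Fin (n + 1)) (j : Fin n) :
      Rel n (dF n a * fF n j - fF n j * dF n a)
        ((-delta (a.val + 1) (j.val + 1)
            + delta (a.val + 1) ((j.val + 1) + 1)
            + delta (2 * n + 2 - (a.val + 1)) ((j.val + 1) + 1)) • fF n j)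
  /-- `[e_i, f_j] = δ_{ij} (d_i - d_{i + 1})` for all `1 ≤ i, j ≤ n` with `(i, j) ≠ (n, n)`. -/
  | ef (i j : Fin n) (hij : ¬ (i.val + 1 = n ∧ j.val + 1 = n)) :
      Rel n (eF n i * fF n j - fF n j * eF n i)
        (delta (i.val + 1) (j.val + 1) • (dF n i.castSucc - dF n i.succ))
  | eSerre (i j : Fin n) (hij : i.val + 1 = j.val ∨ j.val + 1 = i.val) :
      Rel n (eF n i ^ 2 * eF n j - 2 * eF n i * eF n j * eF n i + eF n j * eF n i ^ 2) 0
  | fSerre (i j : Fin n) (hij : i.val + 1 = j.val ∨ j.val + 1 = i.val) :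
      Rel n (fF n i ^ 2 * fF n j - 2 * fF n i * fF n j * fF n i + fF n j * fF n i ^ 2) 0
  | ee (i j : Fin n) (hij : i.val + 1 < j.val ∨ j.val + 1 < i.val) :
      Rel n (eF n i * eF n j) (eF n j * eF n i)
  | ff (i j : Fin n) (hij : i.val + 1 < j.val ∨ j.val + 1 < i.val) :
      Rel n (fF n i * fF n j) (fF n j * fF n i)
  | efn (i : Fin n) (hi : i.val + 1 = n) :
      Rel n (eF n i ^ 2 * fF n i - 2 * eF n i * fF n i * eF n i + fF n i * eF n i ^ 2)
        (-4 * eF n i)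
  | fen (i : Fin n) (hi : i.val + 1 = n) :
      Rel n (fF n i ^ 2 * eF n i - 2 * fF n i * eF n i * fF n i + eF n i * fF n i ^ 2)
        (-4 * fF n i)

/-- The associative unital `ℂ`-algebra given by the generators and the relations above: the free
algebra modulo the two-sided ideal generated by the relations. -/
abbrev Presented (n : ℕ) : Type := RingQuot (Rel n)

/-- The class of a symbol in the presented algebra. -/
def presGen (n : ℕ) (x : Gen n) : Presented n := RingQuot.mkAlgHom ℂ (Rel n) (FreeAlgebra.ι ℂ x)

end FixedPointGL

end

/-! A matrix is fixed by `θ` exactly when it commutes with the reversal of the coordinates of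
`ℂ^(2n+1)`, so it preserves the `±1` eigenspaces, of dimensions `n + 1` and `n`. This embeds `𝔤^θ`
in `𝔤𝔩_{n+1} × 𝔤𝔩_n` (`blocks`), in fact as all of it. For `i < n` the generators `𝐞_i`, `𝐟_i` go to
the Chevalley generators of both factors at once, while `𝐞_n`, `𝐟_n / 2` and `𝐝_{n+1} / 2` go to the
last ones of the first factor alone. The relations can therefore be checked on matrix units.

For completeness, let elements of any complex Lie algebra satisfy the relations, written with
brackets (`IsFixedSerre`). The generators with `i < n`, together with `d_1, …, d_n`, satisfy Serre's
relations and give matrix units `P` of `𝔤𝔩_n`. Under `P`, `e_n` generates a copy `a` of the standard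
representation and `f_n` a copy `b` of its dual (`IsPreSerre.exists_isVecPair`). Equivariance
spreads the relation `⁅⁅e_n, f_n⁆, e_n⁆ = 4 e_n` to all `⁅⁅a_i, b_j⁆, a_k⁆` (`lie_lie_vec`). With `c
= d_{n+1} / 2`, the elements `Q_ij = ½ ⁅a_i, b_j⁆ + δ_ij c` are again matrix units of `𝔤𝔩_n`;
bordered by `a`, `b / 2`, `c` they become matrix units of `𝔤𝔩_{n+1}`, and `R = P - Q` is a system of
type `𝔤𝔩_n` commuting with them (`IsPreSerre.exists_isSplitting`).

Applied to the presented algebra with its commutator, this gives a Lie homomorphism from `𝔤^θ`,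
hence an algebra homomorphism from `U(𝔤^θ)`. It inverts the obvious map, since both composites fix
the generators and these generate `𝔤^θ` as a Lie algebra. No basis of `U(𝔤^θ)` is needed. -/

noncomputable section

namespace FixedPointGL

attribute [local instance 100] LieRing.ofAssociativeRing

/-! ### Abstract matrix units and their standard representation -/

section GeneralLinearSystems

variable {L : Type*} [LieRing L]

/-- The elements `P i j` (`i, j < m`) satisfy the commutation relations of the matrix units
of `𝔤𝔩_m`. -/
def IsGL (m : ℕ) (P : ℕ → ℕ → L) : Prop :=
  ∀ i < m, ∀ j < m, ∀ k < m, ∀ l < m,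
    ⁅P i j, P k l⁆ = (if j = k then P i l else 0) - (if i = l then P k j else 0)

/-- The elements `a i` (`i < m`) transform under `P` like the standard basis of `ℂ^m`. -/
def IsVec (m : ℕ) (P : ℕ → ℕ → L) (a : ℕ → L) : Prop :=
  ∀ i < m, ∀ j < m, ∀ k < m, ⁅P i j, a k⁆ = if j = k then a i else 0

/-- The contragredient system. -/
def contra (P : ℕ → ℕ → L) (i j : ℕ) : L := -P j i

theorem contra_contra (P : ℕ → ℕ → L) : contra (contra P) = P := by
  funext i j
  exact neg_neg _

/-- Because `X ↦ -Xᵀ` is an automorphism of `𝔤𝔩_m`. It lets every result on the standard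
representation be reused for the dual one. -/
theorem IsGL.contra {m : ℕ} {P : ℕ → ℕ → L} (hP : IsGL m P) : IsGL m (contra P) := by
  intro i hi j hj k hk l hl
  have := hP j hj i hi l hl k hk
  simp only [FixedPointGL.contra, neg_lie, lie_neg, neg_neg, this]
  split_ifs <;> simp_all [neg_add_eq_sub]

theorem isVec_contra {m : ℕ} {P : ℕ → ℕ → L} {b : ℕ → L} (hb : IsVec m (contra P) b)
    {i j k : ℕ} (hi : i < m) (hj : j < m) (hk : k < m) :
    ⁅P i j, b k⁆ = -if i = k then b j else 0 := by
  rw [← hb j hj i hi k hk, contra, neg_lie, neg_neg]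

theorem IsGL.upper_induction {m : ℕ} {P : ℕ → ℕ → L} (hP : IsGL m P) (S : L → Prop)
    (hS : ∀ x y, S x → S y → S ⁅x, y⁆) {i j : ℕ} (hij : i < j) (hj : j < m)
    (h : ∀ k, i ≤ k → k < j → S (P k (k + 1))) : S (P i j) := by
  induction j, hij using Nat.le_induction with
  | base => exact h i le_rfl (Nat.lt_succ_self i)
  | succ j hij ih =>
    have h1 := ih (by omega) fun k h1 h2 => h k h1 (by omega)
    have h2 := hS _ _ h1 (h j (by omega) (by omega))
    rw [hP i (by omega) j (by omega) j (by omega) (j + 1) hj] at h2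
    simpa [show i ≠ j + 1 by omega] using h2

theorem IsGL.lower_induction {m : ℕ} {P : ℕ → ℕ → L} (hP : IsGL m P) (S : L → Prop)
    (hS : ∀ x y, S x → S y → S ⁅x, y⁆) {i j : ℕ} (hij : i < j) (hj : j < m)
    (h : ∀ k, i ≤ k → k < j → S (P (k + 1) k)) : S (P j i) := by
  induction j, hij using Nat.le_induction with
  | base => exact h i le_rfl (Nat.lt_succ_self i)
  | succ j hij ih =>
    have h1 := ih (by omega) fun k h1 h2 => h k h1 (by omega)
    have h2 := hS _ _ (h j (by omega) (by omega)) h1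
    rw [hP (j + 1) hj j (by omega) j (by omega) i (by omega)] at h2
    simpa [show j + 1 ≠ i by omega] using h2

/-- A system of matrix units is generated by its diagonal and the two adjacent diagonals. -/
theorem IsGL.induction {m : ℕ} {P : ℕ → ℕ → L} (hP : IsGL m P) (S : L → Prop)
    (hS : ∀ x y, S x → S y → S ⁅x, y⁆) (hd : ∀ i < m, S (P i i))
    (he : ∀ i, i + 1 < m → S (P i (i + 1))) (hf : ∀ i, i + 1 < m → S (P (i + 1) i))
    {i j : ℕ} (hi : i < m) (hj : j < m) : S (P i j) := by
  rcases lt_trichotomy i j with h | rfl | h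
  · exact hP.upper_induction S hS h hj fun k _ _ => he k (by omega)
  · exact hd i hi
  · exact hP.lower_induction S hS h hi fun k _ _ => hf k (by omega)

theorem lie_lie_eq_zero {v : L} (x y : L) (hx : ⁅x, v⁆ = 0) (hy : ⁅y, v⁆ = 0) :
    ⁅⁅x, y⁆, v⁆ = 0 := by
  rw [lie_lie, hx, hy, lie_zero, lie_zero, sub_zero]

/-- `v` is a lowest weight vector of the standard representation. -/
structure IsLowest (N : ℕ) (P : ℕ → ℕ → L) (v : L) : Prop where
  weight : ∀ i ≤ N, ⁅P i i, v⁆ = if i = N then v else 0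
  lower : ∀ i < N, ⁅P (i + 1) i, v⁆ = 0
  upper : ∀ i, i + 1 < N → ⁅P i (i + 1), v⁆ = 0
  serre : ∀ i, i + 1 = N → ⁅P i N, ⁅P i N, v⁆⁆ = 0

/-- The elements killing `v` are closed under brackets, and those `P i j` are brackets of the
adjacent or diagonal units that kill `v`. The only adjacent unit that may not kill it is `P (N - 1)
N`. -/
theorem IsLowest.annihilate {N : ℕ} {P : ℕ → ℕ → L} {v : L} (hv : IsLowest N P v)
    (hP : IsGL (N + 1) P) {i j : ℕ} (hi : i ≤ N) (hj : j < N) : ⁅P i j, v⁆ = 0 := by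
  rcases lt_trichotomy i j with h | rfl | h
  · exact hP.upper_induction (fun x => ⁅x, v⁆ = 0) lie_lie_eq_zero h (by omega)
      fun k _ _ => hv.upper k (by omega)
  · simpa [hj.ne] using hv.weight i hi
  · exact hP.lower_induction (fun x => ⁅x, v⁆ = 0) lie_lie_eq_zero h (by omega)
      fun k _ _ => hv.lower k (by omega)

theorem eq_zero_of_add_self [LieAlgebra ℂ L] {x : L} (h : x + x = 0) : x = 0 := by
  rw [← two_smul ℂ] at h
  exact (smul_eq_zero.1 h).resolve_left two_ne_zero

/-- The operators `P i N` with `i < N` commute, so the double brackets form a symmetric array. `P p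
(N - 1)` with `p < N - 1` kills `v` and replaces an index `N - 1` by `p`; starting from the Serre
relation, which is the entry `(N - 1, N - 1)`, it reaches all entries. -/
theorem IsLowest.lie_lie_last [LieAlgebra ℂ L] {N : ℕ} {P : ℕ → ℕ → L} {v : L}
    (hv : IsLowest N P v) (hP : IsGL (N + 1) P) {i k : ℕ} (hi : i < N) (hk : k < N) :
    ⁅P i N, ⁅P k N, v⁆⁆ = 0 := by
  obtain ⟨M, rfl⟩ : ∃ M, N = M + 1 := ⟨N - 1, by omega⟩
  have comm : ∀ i k, i ≤ M → k ≤ M →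
      ⁅P i (M + 1), ⁅P k (M + 1), v⁆⁆ = ⁅P k (M + 1), ⁅P i (M + 1), v⁆⁆ := by
    intro i k hi hk
    rw [leibniz_lie, hP i (by omega) _ (by omega) k (by omega) _ (by omega),
      if_neg (by omega), if_neg (by omega), sub_zero, zero_lie, zero_add]
  have act : ∀ p i k, p < M → i ≤ M → k ≤ M →
      ⁅P p M, ⁅P i (M + 1), ⁅P k (M + 1), v⁆⁆⁆ =
        (if M = i then ⁅P p (M + 1), ⁅P k (M + 1), v⁆⁆ else 0) +
        (if M = k then ⁅P i (M + 1), ⁅P p (M + 1), v⁆⁆ else 0) := by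
    intro p i k hp hi hk
    rw [leibniz_lie, leibniz_lie (P p M) (P k (M + 1)) v,
      hv.annihilate hP (i := p) (j := M) (by omega) (by omega),
      hP p (by omega) M (by omega) i (by omega) (M + 1) (by omega),
      hP p (by omega) M (by omega) k (by omega) (M + 1) (by omega),
      if_neg (show ¬p = M + 1 by omega), if_neg (show ¬p = M + 1 by omega)]
    split_ifs <;> simp
  have h0 := hv.serre M rfl
  have h1 : ∀ p ≤ M, ⁅P p (M + 1), ⁅P M (M + 1), v⁆⁆ = 0 := by
    intro p hp
    rcases hp.eq_or_lt with rfl | hp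
    · exact h0
    · have h := act p M M hp le_rfl le_rfl
      -- Both indices `M` get replaced in turn, giving twice the wanted entry.
      rw [h0, lie_zero, if_pos rfl, if_pos rfl, comm M p le_rfl hp.le] at h
      exact eq_zero_of_add_self h.symm
  rcases (Nat.lt_succ_iff.1 hk).eq_or_lt with rfl | hk
  · exact h1 i (by omega)
  rcases (Nat.lt_succ_iff.1 hi).eq_or_lt with rfl | hi
  · rw [comm _ _ le_rfl hk.le]
    exact h1 k hk.le
  · have h := act k i M hk hi.le le_rfl
    rw [h1 i hi.le, lie_zero, if_neg (by omega), if_pos rfl, zero_add] at h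
    exact h.symm

/-- A lowest weight vector generates a copy of the standard representation. -/
theorem IsLowest.isVec [LieAlgebra ℂ L] {N : ℕ} {P : ℕ → ℕ → L} {v : L}
    (hv : IsLowest N P v) (hP : IsGL (N + 1) P) : IsVec (N + 1) P fun i => ⁅P i N, v⁆ := by
  have hw : ⁅P N N, v⁆ = v := by simpa using hv.weight N le_rfl
  intro i hi j hj k hk
  dsimp only
  rcases (Nat.lt_succ_iff.1 hj).eq_or_lt with rfl | hjN
  · rcases (Nat.lt_succ_iff.1 hk).eq_or_lt with rfl | hkN
    · rw [hw, if_pos rfl]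
    rw [if_neg hkN.ne']
    rcases (Nat.lt_succ_iff.1 hi).eq_or_lt with rfl | hiN
    · rw [leibniz_lie, hw, hP i hi i hi k hk i hi, if_neg hkN.ne', if_pos rfl, zero_sub,
        neg_lie, neg_add_cancel]
    · exact hv.lie_lie_last hP hiN hkN
  · rw [leibniz_lie, hv.annihilate hP (by omega) hjN, lie_zero, add_zero,
      hP i hi j hj k hk N (by omega), sub_lie]
    have : ⁅P k j, v⁆ = 0 := hv.annihilate hP (by omega) hjN
    split_ifs <;> simp [this]

/-- The bracket is an equivariant map on `Λ²` of the standard representation, which is generated by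
one pair of neighbours: `P i (N - 1)` moves the second index of `⁅a N, a (N - 1)⁆`, then `P i N` the
first. For `N = 0` there is nothing to assume. -/
theorem IsVec.lie_eq_zero {N : ℕ} {P : ℕ → ℕ → L} {a : ℕ → L} (ha : IsVec (N + 1) P a)
    (h : ∀ i, i + 1 = N → ⁅a N, a i⁆ = 0) {i j : ℕ} (hi : i ≤ N) (hj : j ≤ N) :
    ⁅a i, a j⁆ = 0 := by
  have h1 : ∀ i ≤ N, ⁅a N, a i⁆ = 0 := by
    intro i hi
    rcases hi.eq_or_lt with rfl | hi
    · exact lie_self _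
    obtain ⟨M, rfl⟩ : ∃ M, N = M + 1 := ⟨N - 1, by omega⟩
    rcases (Nat.lt_succ_iff.1 hi).eq_or_lt with rfl | hiM
    · exact h i rfl
    · have h2 := leibniz_lie (P i M) (a (M + 1)) (a M)
      rw [h M rfl, ha i (by omega) M (by omega) (M + 1) (by omega),
        ha i (by omega) M (by omega) M (by omega), if_neg (by omega), if_pos rfl] at h2
      simpa using h2.symm
  rcases hj.eq_or_lt with rfl | hj
  · rw [← lie_skew, h1 i hi, neg_zero]
  · have h2 := leibniz_lie (P i N) (a N) (a j)
    rw [h1 j hj.le, ha i (by omega) N (by omega) N (by omega),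
      ha i (by omega) N (by omega) j (by omega), if_pos rfl, if_neg (by omega)] at h2
    simpa using h2.symm

end GeneralLinearSystems

/-! ### Adding a row and a column: Serre's relations for `𝔤𝔩_m` -/

section Extension

variable {L : Type*} [LieRing L]

/-- The Serre relations of `𝔤𝔩_m`, except for those that express `⁅e i, f i⁆`. -/
structure IsPreSerre (m : ℕ) (e f d : ℕ → L) : Prop where
  dd : ∀ a < m, ∀ b < m, ⁅d a, d b⁆ = 0
  de : ∀ a < m, ∀ j, j + 1 < m →
    ⁅d a, e j⁆ = (if a = j then e j else 0) - if a = j + 1 then e j else 0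
  df : ∀ a < m, ∀ j, j + 1 < m →
    ⁅d a, f j⁆ = (if a = j + 1 then f j else 0) - if a = j then f j else 0
  ef : ∀ i j, i + 1 < m → j + 1 < m → i ≠ j → ⁅e i, f j⁆ = 0
  ee : ∀ i j, i + 1 < j → j + 1 < m → ⁅e i, e j⁆ = 0
  ff : ∀ i j, i + 1 < j → j + 1 < m → ⁅f i, f j⁆ = 0
  e_e_succ : ∀ i, i + 2 < m → ⁅e i, ⁅e i, e (i + 1)⁆⁆ = 0
  e_succ_e : ∀ i, i + 2 < m → ⁅e (i + 1), ⁅e (i + 1), e i⁆⁆ = 0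
  f_f_succ : ∀ i, i + 2 < m → ⁅f i, ⁅f i, f (i + 1)⁆⁆ = 0
  f_succ_f : ∀ i, i + 2 < m → ⁅f (i + 1), ⁅f (i + 1), f i⁆⁆ = 0

theorem IsPreSerre.mono {m m' : ℕ} {e f d : ℕ → L} (h : IsPreSerre m e f d) (hm : m' ≤ m) :
    IsPreSerre m' e f d where
  dd a ha b hb := h.dd a (by omega) b (by omega)
  de a ha j hj := h.de a (by omega) j (by omega)
  df a ha j hj := h.df a (by omega) j (by omega)
  ef i j hi hj := h.ef i j (by omega) (by omega)
  ee i j hij hj := h.ee i j hij (by omega)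
  ff i j hij hj := h.ff i j hij (by omega)
  e_e_succ i hi := h.e_e_succ i (by omega)
  e_succ_e i hi := h.e_succ_e i (by omega)
  f_f_succ i hi := h.f_f_succ i (by omega)
  f_succ_f i hi := h.f_succ_f i (by omega)

/-- `P` is a system of matrix units whose Chevalley generators are `e`, `f`, `d`. -/
structure IsGLWith (m : ℕ) (P : ℕ → ℕ → L) (e f d : ℕ → L) : Prop where
  isGL : IsGL m P
  diag : ∀ i < m, P i i = d i
  upper : ∀ i, i + 1 < m → P i (i + 1) = e i
  lower : ∀ i, i + 1 < m → P (i + 1) i = f i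

/-- A copy of the standard representation and one of its dual, each of them commutative, and an
element of the centralizer of `P` which acts on them by `-1` and `1`. -/
structure IsVecPair (m : ℕ) (P : ℕ → ℕ → L) (a b : ℕ → L) (c : L) : Prop where
  vec : IsVec m P a
  covec : IsVec m (contra P) b
  lie_vec : ∀ i < m, ∀ j < m, ⁅a i, a j⁆ = 0
  lie_covec : ∀ i < m, ∀ j < m, ⁅b i, b j⁆ = 0
  lie_left : ∀ i < m, ⁅c, a i⁆ = -a i
  lie_right : ∀ i < m, ⁅c, b i⁆ = b i
  lie_gl : ∀ i < m, ∀ j < m, ⁅c, P i j⁆ = 0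

/-- The relations between `e N` and the earlier generators say that `e N` is a lowest weight vector,
and likewise `f N` for the dual; the other Serre relation at the last edge makes each family
commutative. The value of `⁅e N, f N⁆` plays no role, so this serves both the induction for `𝔤𝔩_m`
and the splitting, where that bracket is unknown. -/
theorem IsPreSerre.exists_isVecPair [LieAlgebra ℂ L] {N : ℕ} {e f d : ℕ → L} {P : ℕ → ℕ → L}
    (h : IsPreSerre (N + 2) e f d) (hP : IsGLWith (N + 1) P e f d) :
    ∃ a b : ℕ → L, a N = e N ∧ b N = f N ∧ IsVecPair (N + 1) P a b (d (N + 1)) := by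
  have hcP : ∀ i < N + 1, ∀ j < N + 1, ⁅d (N + 1), P i j⁆ = 0 := by
    intro i hi j hj
    refine hP.isGL.induction (fun x => ⁅d (N + 1), x⁆ = 0)
      (fun x y hx hy => by rw [leibniz_lie, hx, hy, zero_lie, lie_zero, add_zero])
      (fun i hi => ?_) (fun i hi => ?_) (fun i hi => ?_) hi hj
    · rw [hP.diag i hi, h.dd _ (by omega) _ (by omega)]
    · rw [hP.upper i hi, h.de _ (by omega) _ (by omega), if_neg (by omega), if_neg (by omega),
        sub_zero]
    · rw [hP.lower i hi, h.df _ (by omega) _ (by omega), if_neg (by omega), if_neg (by omega),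
        sub_zero]
  have he : IsLowest N P (e N) := by
    refine ⟨fun i hi => ?_, fun i hi => ?_, fun i hi => ?_, ?_⟩
    · rw [hP.diag i (by omega), h.de i (by omega) N (by omega), if_neg (show ¬i = N + 1 by omega),
        sub_zero]
    · rw [hP.lower i (by omega), ← lie_skew, h.ef N i (by omega) (by omega) (by omega), neg_zero]
    · rw [hP.upper i (by omega), h.ee i N hi (by omega)]
    · rintro i rfl
      rw [hP.upper i (by omega), h.e_e_succ i (by omega)]
  have hf : IsLowest N (contra P) (f N) := by
    refine ⟨fun i hi => ?_, fun i hi => ?_, fun i hi => ?_, ?_⟩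
    · rw [contra, neg_lie, hP.diag i (by omega), h.df i (by omega) N (by omega),
        if_neg (show ¬i = N + 1 by omega), zero_sub, neg_neg]
    · rw [contra, neg_lie, hP.upper i (by omega), h.ef i N (by omega) (by omega) (by omega),
        neg_zero]
    · rw [contra, neg_lie, hP.lower i (by omega), h.ff i N hi (by omega), neg_zero]
    · rintro i rfl
      rw [contra, neg_lie, neg_lie, lie_neg, hP.lower i (by omega), h.f_f_succ i (by omega),
        neg_zero, neg_zero]
  have heN : ⁅P N N, e N⁆ = e N := by simpa using he.weight N le_rfl
  have hfN : ⁅contra P N N, f N⁆ = f N := by simpa using hf.weight N le_rfl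
  have hde : ⁅d (N + 1), e N⁆ = -e N := by
    rw [h.de _ (by omega) _ (by omega), if_neg (by omega), if_pos rfl, zero_sub]
  have hdf : ⁅d (N + 1), f N⁆ = f N := by
    rw [h.df _ (by omega) _ (by omega), if_pos rfl, if_neg (by omega), sub_zero]
  have hva := he.isVec hP.isGL
  have hvb := hf.isVec hP.isGL.contra
  refine ⟨fun i => ⁅P i N, e N⁆, fun i => ⁅contra P i N, f N⁆, heN, hfN, hva, hvb,
    fun i hi j hj => hva.lie_eq_zero ?_ (by omega) (by omega),
    fun i hi j hj => hvb.lie_eq_zero ?_ (by omega) (by omega), fun i hi => ?_, fun i hi => ?_, hcP⟩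
  · rintro i rfl
    rw [heN, hP.upper i (by omega), ← lie_skew (e i), lie_neg, h.e_succ_e i (by omega), neg_zero]
  · rintro i rfl
    rw [hfN, contra, hP.lower i (by omega), neg_lie, ← lie_skew (f i), neg_neg,
      h.f_succ_f i (by omega)]
  · rw [leibniz_lie, hcP i hi N (by omega), zero_lie, zero_add, hde, lie_neg]
  · rw [leibniz_lie, contra, lie_neg, hcP N (by omega) i hi, neg_zero, zero_lie, zero_add, hdf]

/-- Extends an `m × m` array by a column `a`, a row `b` and a corner `c`. -/
def bordered (m : ℕ) (P : ℕ → ℕ → L) (a b : ℕ → L) (c : L) (i j : ℕ) : L :=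
  if i < m then if j < m then P i j else a i else if j < m then b j else c

theorem isGL_bordered {m : ℕ} {P : ℕ → ℕ → L} {a b : ℕ → L} {c : L} (hP : IsGL m P)
    (h : IsVecPair m P a b c)
    (hab : ∀ i < m, ∀ j < m, ⁅a i, b j⁆ = P i j - if i = j then c else 0) :
    IsGL (m + 1) (bordered m P a b c) := by
  have hb : ∀ i < m, ∀ j < m, ∀ k < m, ⁅P i j, b k⁆ = -if i = k then b j else 0 :=
    fun i hi j hj k hk => isVec_contra h.covec hi hj hk
  have skew : ∀ {x y z : L}, ⁅x, y⁆ = z → ⁅y, x⁆ = -z := by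
    rintro x y z rfl
    exact (lie_skew _ _).symm
  intro i hi j hj k hk l hl
  have hne : ∀ i < m, ¬i = m := fun i hi => hi.ne
  have hne' : ∀ i < m, ¬m = i := fun i hi => hi.ne'
  -- Sixteen cases, according to which of the four indices equal `m`.
  rcases Nat.lt_succ_iff_lt_or_eq.1 hi with hi | rfl <;>
    rcases Nat.lt_succ_iff_lt_or_eq.1 hj with hj | rfl <;>
    rcases Nat.lt_succ_iff_lt_or_eq.1 hk with hk | rfl <;>
    rcases Nat.lt_succ_iff_lt_or_eq.1 hl with hl | rfl <;>
    simp only [bordered, hi, hj, hk, hl, hne, hne', if_true, lt_irrefl, if_false, sub_zero,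
      zero_sub]
  · exact hP i hi j hj k hk l hl
  · exact h.vec i hi j hj k hk
  · exact hb i hi j hj l hl
  · rw [skew (h.lie_gl i hi j hj), neg_zero]
  · rw [skew (h.vec k hk l hl i hi)]
    simp only [eq_comm]
  · exact h.lie_vec i hi k hk
  · exact hab i hi l hl
  · rw [skew (h.lie_left i hi), neg_neg]
  · rw [skew (hb k hk l hl j hj), neg_neg]
    simp only [eq_comm]
  · rw [skew (hab k hk j hj), neg_sub]
    simp only [eq_comm]
  · exact h.lie_covec j hj l hl
  · exact skew (h.lie_right j hj)
  · exact h.lie_gl k hk l hl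
  · exact h.lie_left k hk
  · exact h.lie_right l hl
  · rw [lie_self, sub_self]

/-- Equivariance again: `P i N` moves `a N` to `a i`, and then `P N j` moves `b N` to `-b j`, so the
corner bracket determines the others. -/
theorem IsVecPair.lie_eq {N : ℕ} {P : ℕ → ℕ → L} {a b : ℕ → L} {c : L} (hP : IsGL (N + 1) P)
    (h : IsVecPair (N + 1) P a b c) (hN : ⁅a N, b N⁆ = P N N - c) :
    ∀ i < N + 1, ∀ j < N + 1, ⁅a i, b j⁆ = P i j - if i = j then c else 0 := by
  have hb : ∀ i < N + 1, ∀ j < N + 1, ∀ k < N + 1, ⁅P i j, b k⁆ = -if i = k then b j else 0 :=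
    fun i hi j hj k hk => isVec_contra h.covec hi hj hk
  have hPc : ∀ i < N + 1, ∀ j < N + 1, ⁅P i j, c⁆ = 0 := fun i hi j hj => by
    rw [← lie_skew, h.lie_gl i hi j hj, neg_zero]
  have h1 : ∀ i < N + 1, ⁅a i, b N⁆ = P i N - if i = N then c else 0 := by
    intro i hi
    rcases Nat.lt_succ_iff_lt_or_eq.1 hi with hiN | rfl
    · have h2 := leibniz_lie (P i N) (a N) (b N)
      rw [hN, lie_sub, hPc i hi N (by omega), hP i hi N (by omega) N (by omega) N (by omega),
        h.vec i hi N (by omega) N (by omega), hb i hi N (by omega) N (by omega)] at h2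
      simpa [hiN.ne] using h2.symm
    · rw [hN, if_pos rfl]
  intro i hi j hj
  rcases Nat.lt_succ_iff_lt_or_eq.1 hj with hjN | rfl
  · have h2 := leibniz_lie (P N j) (a i) (b N)
    have h3 : ⁅P N j, if i = N then c else 0⁆ = 0 := by
      split_ifs
      · exact hPc _ (by omega) _ hj
      · exact lie_zero _
    rw [h1 i hi, lie_sub, h3, hP N (by omega) j hj i hi N (by omega),
      h.vec N (by omega) j hj i hi, hb N (by omega) j hj N (by omega)] at h2
    -- If `i = j`, then `P N j` also moves `a j` to `a N`, and the known `⁅a N, b N⁆` has to be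
    -- subtracted.
    rcases eq_or_ne j i with rfl | hji
    · simp only [if_true, hN, sub_zero, lie_neg] at h2 ⊢
      calc ⁅a j, b j⁆ = P N N - c - (P N N - c + -⁅a j, b j⁆) := by abel
        _ = P j j - c := by rw [← h2]; abel
    · simp only [if_neg hji, if_true, zero_sub, sub_zero, zero_lie, zero_add, lie_neg,
        neg_inj] at h2
      rw [if_neg hji.symm, sub_zero, h2]
  · exact h1 i hi

/-- Serre's presentation of `𝔤𝔩_m`, by induction on `m`: the last `e` and `f` produce the new column
and row, the last `d` is the corner. -/
theorem IsPreSerre.exists_isGLWith [LieAlgebra ℂ L] (m : ℕ) {e f d : ℕ → L}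
    (h : IsPreSerre m e f d) (hef : ∀ i, i + 1 < m → ⁅e i, f i⁆ = d i - d (i + 1)) :
    ∃ P, IsGLWith m P e f d := by
  induction m with
  | zero => exact ⟨fun _ _ => 0, fun i hi => by omega, fun i hi => by omega,
      fun i hi => by omega, fun i hi => by omega⟩
  | succ m ih =>
    obtain ⟨P, hP⟩ := ih (h.mono (by omega)) fun i hi => hef i (by omega)
    rcases m with _ | N
    · refine ⟨fun _ _ => d 0, fun i hi j hj k hk l hl => ?_, fun i hi => ?_,
        fun i hi => by omega, fun i hi => by omega⟩
      · rw [if_pos (by omega), if_pos (by omega), lie_self, sub_self]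
      · rw [show i = 0 by omega]
    obtain ⟨a, b, haN, hbN, hab⟩ := h.exists_isVecPair hP
    have hN : ⁅a N, b N⁆ = P N N - d (N + 1) := by
      rw [haN, hbN, hef N (by omega), hP.diag N (by omega)]
    refine ⟨bordered (N + 1) P a b (d (N + 1)),
      isGL_bordered hP.isGL hab (hab.lie_eq hP.isGL hN), fun i hi => ?_, fun i hi => ?_,
      fun i hi => ?_⟩ <;> rcases Nat.lt_succ_iff_lt_or_eq.1 hi with hi | hi
    · rw [bordered, if_pos hi, if_pos hi, hP.diag i hi]
    · rw [bordered, if_neg (by omega), if_neg (by omega), hi]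
    · rw [bordered, if_pos (by omega), if_pos hi, hP.upper i hi]
    · obtain rfl : i = N := by omega
      rw [bordered, if_pos (by omega), if_neg (by omega), haN]
    · rw [bordered, if_pos hi, if_pos (by omega), hP.lower i hi]
    · obtain rfl : i = N := by omega
      rw [bordered, if_neg (by omega), if_pos (by omega), hbN]

end Extension

/-! ### The cubic relations and the splitting into two commuting systems -/

section Splitting

variable {L : Type*} [LieRing L] [LieAlgebra ℂ L]

/-- As the `a i` commute, the double bracket is symmetric in `i` and `k`, hence an equivariant map
`Sym² V ⊗ V* → V`. Such a map is a multiple of the contraction, and the entry `(N, N, N)` fixes the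
factor: `4 = 2 (1 + 1)`. The proof moves the indices one at a time with `P i N`, `P k N` and `P N
j`. -/
theorem lie_lie_vec {N : ℕ} {P : ℕ → ℕ → L} {a b : ℕ → L} (ha : IsVec (N + 1) P a)
    (hb : IsVec (N + 1) (contra P) b) (haa : ∀ i < N + 1, ∀ j < N + 1, ⁅a i, a j⁆ = 0)
    (hN : ⁅⁅a N, b N⁆, a N⁆ = (4 : ℂ) • a N) :
    ∀ i < N + 1, ∀ j < N + 1, ∀ k < N + 1, ⁅⁅a i, b j⁆, a k⁆ =
      (2 : ℂ) • ((if j = k then a i else 0) + if i = j then a k else 0) := by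
  have symm : ∀ i < N + 1, ∀ j, ∀ k < N + 1, ⁅⁅a i, b j⁆, a k⁆ = ⁅⁅a k, b j⁆, a i⁆ := by
    intro i hi j k hk
    rw [← lie_skew, leibniz_lie, haa k hk i hi, zero_lie, zero_add, lie_skew]
  have act : ∀ p < N + 1, ∀ q < N + 1, ∀ i < N + 1, ∀ j < N + 1, ∀ k < N + 1,
      ⁅P p q, ⁅⁅a i, b j⁆, a k⁆⁆ = (if q = i then ⁅⁅a p, b j⁆, a k⁆ else 0) -
        (if p = j then ⁅⁅a i, b q⁆, a k⁆ else 0) + if q = k then ⁅⁅a i, b j⁆, a p⁆ else 0 := by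
    intro p hp q hq i hi j hj k hk
    rw [leibniz_lie, leibniz_lie, ha p hp q hq i hi, ha p hp q hq k hk, isVec_contra hb hp hq hj]
    split_ifs <;> simp only [zero_lie, lie_zero, lie_neg, neg_zero, sub_eq_add_neg,
      add_lie, neg_lie, add_zero]
  have h1 : ∀ i < N + 1, ⁅⁅a i, b N⁆, a N⁆ = (2 : ℂ) • (a i + if i = N then a N else 0) := by
    intro i hi
    rcases Nat.lt_succ_iff_lt_or_eq.1 hi with hiN | rfl
    · have h := act i hi N (by omega) N (by omega) N (by omega) N (by omega)
      rw [hN, lie_smul, ha i hi N (by omega) N (by omega), if_pos rfl, if_pos rfl, if_pos rfl,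
        if_neg hiN.ne, sub_zero, symm N (by omega) N i hi] at h
      rw [if_neg hiN.ne]
      -- `P i N` hits both outer vectors, and by symmetry the two terms agree.
      calc ⁅⁅a i, b N⁆, a N⁆ = (1 / 2 : ℂ) • (⁅⁅a i, b N⁆, a N⁆ + ⁅⁅a i, b N⁆, a N⁆) := by module
        _ = (2 : ℂ) • (a i + 0) := by rw [← h]; module
    · rw [hN, if_pos rfl]
      module
  have h2 : ∀ i < N + 1, ∀ k < N + 1, ⁅⁅a i, b N⁆, a k⁆ =
      (2 : ℂ) • ((if N = k then a i else 0) + if i = N then a k else 0) := by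
    intro i hi k hk
    rcases Nat.lt_succ_iff_lt_or_eq.1 hk with hkN | rfl
    · rcases Nat.lt_succ_iff_lt_or_eq.1 hi with hiN | rfl
      · have h := act k hk N (by omega) i hi N (by omega) N (by omega)
        rw [h1 i hi, if_neg hiN.ne, add_zero, lie_smul, ha k hk N (by omega) i hi,
          if_neg hiN.ne', if_neg hiN.ne', if_neg hkN.ne, if_pos rfl, smul_zero, sub_zero,
          zero_add] at h
        rw [← h, if_neg hkN.ne', if_neg hiN.ne, add_zero, smul_zero]
      · rw [symm i hi i k hk, h1 k hk, if_neg hkN.ne, if_neg hkN.ne', if_pos rfl, add_comm]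
    · rw [h1 i hi, if_pos rfl]
  intro i hi j hj k hk
  rcases Nat.lt_succ_iff_lt_or_eq.1 hj with hjN | rfl
  · have h := act N (by omega) j hj i hi N (by omega) k hk
    rw [h2 i hi k hk, h2 N (by omega) k hk, h2 i hi N (by omega), lie_smul, lie_add,
      if_pos rfl, if_pos rfl] at h
    have h3 : ⁅P N j, if N = k then a i else 0⁆ = if N = k ∧ j = i then a N else 0 := by
      by_cases hNk : N = k
      · rw [if_pos hNk, ha N (by omega) j hj i hi]; simp [hNk]
      · simp [hNk]
    have h4 : ⁅P N j, if i = N then a k else 0⁆ = if i = N ∧ j = k then a N else 0 := by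
      by_cases hiN : i = N
      · rw [if_pos hiN, ha N (by omega) j hj k hk]; simp [hiN]
      · simp [hiN]
    rw [h3, h4, if_pos rfl] at h
    -- The identity `h` solved for the term in which `P N j` turns `b N` into `-b j`; the rest is
    -- known from `h2`.
    have h5 : ⁅⁅a i, b j⁆, a k⁆ =
        (if j = i then (2 : ℂ) • ((if N = k then a N else 0) + a k) else 0) +
        (if j = k then (2 : ℂ) • (a i + if i = N then a N else 0) else 0) -
        (2 : ℂ) • ((if N = k ∧ j = i then a N else 0) + if i = N ∧ j = k then a N else 0) := by
      rw [h]; abel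
    rw [h5]
    simp only [eq_comm (a := i) (b := j)]
    split_ifs <;> first | (exfalso; omega) | module
  · exact h2 i hi k hk

/-- Two commuting systems of matrix units, of sizes `n + 1` and `n`, through which the elements
`e`, `f`, `d` are expressed. -/
structure IsSplitting (n : ℕ) (Q R : ℕ → ℕ → L) (e f d : ℕ → L) : Prop where
  left : IsGL (n + 1) Q
  right : IsGL n R
  comm : ∀ i < n + 1, ∀ j < n + 1, ∀ k < n, ∀ l < n, ⁅Q i j, R k l⁆ = 0
  diag : ∀ i < n, d i = Q i i + R i i
  diag_last : d n = Q n n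
  upper : ∀ i, i + 1 < n → e i = Q i (i + 1) + R i (i + 1)
  lower : ∀ i, i + 1 < n → f i = Q (i + 1) i + R (i + 1) i
  upper_last : ∀ i, i + 1 = n → e i = Q i n
  lower_last : ∀ i, i + 1 = n → f i = (2 : ℂ) • Q n i

/-- The cubic relations make the elements `⁅a i, b j⁆` act on `a`, `b` and on each other like
multiples of matrix units corrected by the trace. The last clause says that `P` and `Q` act alike on
`Q`, so that `P - Q` centralizes it. -/
theorem IsVecPair.exists_splitting {N : ℕ} {P : ℕ → ℕ → L} {a b : ℕ → L} {c : L}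
    (h : IsVecPair (N + 1) P a b c)
    (hN : ⁅⁅a N, b N⁆, a N⁆ = (4 : ℂ) • a N) (hN' : ⁅⁅b N, a N⁆, b N⁆ = (4 : ℂ) • b N) :
    ∃ Q : ℕ → ℕ → L, IsGL (N + 1) Q ∧ IsVecPair (N + 1) Q a (fun i => (1 / 2 : ℂ) • b i) c ∧
      (∀ i < N + 1, ∀ j < N + 1,
        ⁅a i, (1 / 2 : ℂ) • b j⁆ = Q i j - if i = j then c else 0) ∧
      (∀ i < N + 1, ∀ j < N + 1, ∀ k < N + 1, ∀ l < N + 1, ⁅P i j, Q k l⁆ = ⁅Q i j, Q k l⁆) := by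
  have hb : ∀ i < N + 1, ∀ j < N + 1, ∀ k < N + 1, ⁅P i j, b k⁆ = -if i = k then b j else 0 :=
    fun i hi j hj k hk => isVec_contra h.covec hi hj hk
  have hXa := lie_lie_vec h.vec h.covec h.lie_vec hN
  have hXb : ∀ i < N + 1, ∀ j < N + 1, ∀ k < N + 1, ⁅⁅a i, b j⁆, b k⁆ =
      (-2 : ℂ) • ((if i = k then b j else 0) + if i = j then b k else 0) := by
    intro i hi j hj k hk
    rw [← lie_skew (a i), neg_lie, lie_lie_vec h.covec ((contra_contra P).symm ▸ h.vec) h.lie_covec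
      hN' j hj i hi k hk, neg_smul]
    rcases eq_or_ne i j with rfl | hij
    · rfl
    · rw [if_neg hij, if_neg hij.symm]
  have hcX : ∀ i < N + 1, ∀ j < N + 1, ⁅c, ⁅a i, b j⁆⁆ = 0 := by
    intro i hi j hj
    rw [leibniz_lie, h.lie_left i hi, h.lie_right j hj, neg_lie, neg_add_cancel]
  have hXc : ∀ i < N + 1, ∀ j < N + 1, ⁅⁅a i, b j⁆, c⁆ = 0 := by
    intro i hi j hj
    rw [← lie_skew, hcX i hi j hj, neg_zero]
  have hPc : ∀ i < N + 1, ∀ j < N + 1, ⁅P i j, c⁆ = 0 := by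
    intro i hi j hj
    rw [← lie_skew, h.lie_gl i hi j hj, neg_zero]
  have hPX : ∀ i < N + 1, ∀ j < N + 1, ∀ k < N + 1, ∀ l < N + 1, ⁅P i j, ⁅a k, b l⁆⁆ =
      (if j = k then ⁅a i, b l⁆ else 0) - if i = l then ⁅a k, b j⁆ else 0 := by
    intro i hi j hj k hk l hl
    rw [leibniz_lie, h.vec i hi j hj k hk, hb i hi j hj l hl, lie_neg, ← sub_eq_add_neg]
    congr 1 <;> split_ifs <;> simp only [zero_lie, lie_zero]
  have hXX : ∀ i < N + 1, ∀ j < N + 1, ∀ k < N + 1, ∀ l < N + 1, ⁅⁅a i, b j⁆, ⁅a k, b l⁆⁆ =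
      (2 : ℂ) • ((if j = k then ⁅a i, b l⁆ else 0) - if i = l then ⁅a k, b j⁆ else 0) := by
    intro i hi j hj k hk l hl
    rw [leibniz_lie, hXa i hi j hj k hk, hXb i hi j hj l hl, smul_lie, lie_smul, add_lie, lie_add]
    split_ifs <;> simp only [smul_add, zero_lie, lie_zero] <;> module
  -- In the model, with `m = N + 1`, one has `a i = E_{i,m}`, `b j = 2 E_{m,j}`, `c = E_{m,m}`, so
  -- this formula returns `E_{i,j}`.
  let Q : ℕ → ℕ → L := fun i j => (1 / 2 : ℂ) • ⁅a i, b j⁆ + if i = j then c else 0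
  have hite : ∀ {x : L} (p : Prop) [Decidable p], ⁅x, c⁆ = 0 → ⁅x, if p then c else 0⁆ = 0 := by
    intro x p _ hx
    split_ifs
    exacts [hx, lie_zero _]
  have hQ' : ∀ {x : L} (i j : ℕ), ⁅x, c⁆ = 0 → ⁅x, Q i j⁆ = (1 / 2 : ℂ) • ⁅x, ⁅a i, b j⁆⁆ := by
    intro x i j hx
    simp only [Q]
    rw [lie_add, lie_smul, hite _ hx, add_zero]
  have hQc : ∀ i < N + 1, ∀ j < N + 1, ⁅Q i j, c⁆ = 0 := by
    intro i hi j hj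
    simp only [Q]
    rw [add_lie, smul_lie, hXc i hi j hj, smul_zero, zero_add, ← lie_skew,
      hite _ (lie_self c), neg_zero]
  have hQX : ∀ i < N + 1, ∀ j < N + 1, ∀ k < N + 1, ∀ l < N + 1,
      ⁅Q i j, ⁅a k, b l⁆⁆ = ⁅P i j, ⁅a k, b l⁆⁆ := by
    intro i hi j hj k hk l hl
    simp only [Q]
    rw [add_lie, smul_lie, hXX i hi j hj k hk l hl, hPX i hi j hj k hk l hl,
      ← lie_skew _ ⁅a k, b l⁆, hite _ (hXc k hk l hl)]
    module
  have hPQ : ∀ i < N + 1, ∀ j < N + 1, ∀ k < N + 1, ∀ l < N + 1,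
      ⁅P i j, Q k l⁆ = ⁅Q i j, Q k l⁆ := by
    intro i hi j hj k hk l hl
    rw [hQ' k l (hPc i hi j hj), hQ' k l (hQc i hi j hj), hQX i hi j hj k hk l hl]
  refine ⟨Q, fun i hi j hj k hk l hl => ?_, ⟨fun i hi j hj k hk => ?_, fun i hi j hj k hk => ?_,
    h.lie_vec, fun i hi j hj => ?_, h.lie_left, fun i hi => ?_, fun i hi j hj => ?_⟩,
    fun i _ j _ => ?_, hPQ⟩
  · rw [← hPQ i hi j hj k hk l hl, hQ' k l (hPc i hi j hj), hPX i hi j hj k hk l hl]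
    simp only [Q]
    split_ifs <;> first | (exfalso; omega) | module
  · simp only [Q]
    have hca : ⁅if i = j then c else 0, a k⁆ = -if i = j then a k else 0 := by
      split_ifs
      · exact h.lie_left k hk
      · rw [zero_lie, neg_zero]
    rw [add_lie, smul_lie, hXa i hi j hj k hk, hca]
    module
  · simp only [Q, contra]
    have hcb : ⁅if j = i then c else 0, b k⁆ = if j = i then b k else 0 := by
      split_ifs
      · exact h.lie_right k hk
      · rw [zero_lie]
    rw [neg_lie, lie_smul, add_lie, smul_lie, hXb j hj i hi k hk, hcb]
    split_ifs <;> module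
  · rw [lie_smul, smul_lie, h.lie_covec i hi j hj, smul_zero, smul_zero]
  · rw [lie_smul, h.lie_right i hi]
  · rw [← lie_skew, hQc i hi j hj, neg_zero]
  · simp only [Q]
    rw [lie_smul, add_sub_cancel_right]

theorem IsPreSerre.exists_isSplitting {n : ℕ} {e f d : ℕ → L} (h : IsPreSerre (n + 1) e f d)
    (hef : ∀ i, i + 1 < n → ⁅e i, f i⁆ = d i - d (i + 1))
    (hefe : ∀ i, i + 1 = n → ⁅⁅e i, f i⁆, e i⁆ = (4 : ℂ) • e i)
    (hfef : ∀ i, i + 1 = n → ⁅⁅f i, e i⁆, f i⁆ = (4 : ℂ) • f i) :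
    ∃ Q R, IsSplitting n Q R e f d := by
  rcases n with _ | N
  -- For `n = 0` only `d 0` is left, and there is no last `e` from which to build `a`.
  · refine ⟨fun _ _ => d 0, fun _ _ => 0, fun i hi j hj k hk l hl => ?_, fun i hi => ?_,
      fun _ _ _ _ k hk => ?_, fun i hi => ?_, rfl, fun i hi => ?_, fun i hi => ?_,
      fun i hi => ?_, fun i hi => ?_⟩
    · rw [if_pos (by omega), if_pos (by omega), lie_self, sub_self]
    all_goals omega
  obtain ⟨P, hP⟩ := (h.mono (Nat.le_succ _)).exists_isGLWith (N + 1) hef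
  obtain ⟨a, b, haN, hbN, hab⟩ := h.exists_isVecPair hP
  obtain ⟨Q, hQ, hQab, hQX, hPQ⟩ := hab.exists_splitting
    (by rw [haN, hbN, hefe N rfl]) (by rw [haN, hbN, hfef N rfl])
  have hQP : ∀ i < N + 1, ∀ j < N + 1, ∀ k < N + 1, ∀ l < N + 1,
      ⁅Q i j, P k l⁆ = ⁅Q i j, Q k l⁆ := by
    intro i hi j hj k hk l hl
    rw [← lie_skew, hPQ k hk l hl i hi j hj, lie_skew]
  refine ⟨bordered (N + 1) Q a (fun i => (1 / 2 : ℂ) • b i) (d (N + 1)), fun i j => P i j - Q i j,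
    isGL_bordered hQ hQab hQX, ?_, ?_, ?_, ?_, ?_, ?_, ?_, ?_⟩
  · intro i hi j hj k hk l hl
    dsimp only
    -- Since `⁅P, Q⁆ = ⁅Q, P⁆ = ⁅Q, Q⁆` index by index, `⁅P - Q, P - Q⁆ = ⁅P, P⁆ - ⁅Q, Q⁆`.
    rw [sub_lie, lie_sub, lie_sub, hPQ i hi j hj k hk l hl, hQP i hi j hj k hk l hl,
      hP.isGL i hi j hj k hk l hl, hQ i hi j hj k hk l hl]
    split_ifs <;> abel
  · intro i hi j hj k hk l hl
    rcases Nat.lt_succ_iff_lt_or_eq.1 hi with hi | rfl <;>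
      rcases Nat.lt_succ_iff_lt_or_eq.1 hj with hj | rfl <;>
      simp only [bordered, hi, hj, if_true, lt_irrefl, if_false, lie_sub]
    · rw [hQP i hi j hj k hk l hl, sub_self]
    · rw [← lie_skew, ← lie_skew (a i), hab.vec k hk l hl i hi, hQab.vec k hk l hl i hi, sub_self]
    · rw [← lie_skew _ (P k l), ← lie_skew _ (Q k l), lie_smul,
        isVec_contra hab.covec hk hl hj, isVec_contra hQab.covec hk hl hj]
      split_ifs <;> module
    · rw [hab.lie_gl k hk l hl, hQab.lie_gl k hk l hl, sub_self]
  · intro i hi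
    rw [bordered, if_pos hi, if_pos hi, add_sub_cancel, hP.diag i hi]
  · rw [bordered, if_neg (by omega), if_neg (by omega)]
  · intro i hi
    rw [bordered, if_pos (by omega), if_pos hi, add_sub_cancel, hP.upper i hi]
  · intro i hi
    rw [bordered, if_pos hi, if_pos (by omega), add_sub_cancel, hP.lower i hi]
  · intro i hi
    obtain rfl : i = N := by omega
    rw [bordered, if_pos (by omega), if_neg (by omega), haN]
  · intro i hi
    obtain rfl : i = N := by omega
    rw [bordered, if_neg (by omega), if_pos (by omega), hbN]
    module

end Splitting

/-! ### Concrete matrix units and homomorphisms out of `𝔤𝔩_m × 𝔤𝔩_k` -/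

section Matrices

variable {L : Type*} [LieRing L] [LieAlgebra ℂ L]

/-- The matrix unit in position `(i, j)`, which is `0` when `i` or `j` is out of range. -/
def stdUnit (m i j : ℕ) : Matrix (Fin m) (Fin m) ℂ :=
  Matrix.of fun p q => if p.val = i ∧ q.val = j then 1 else 0

theorem stdUnit_eq_single {m i j : ℕ} (hi : i < m) (hj : j < m) :
    stdUnit m i j = Matrix.single ⟨i, hi⟩ ⟨j, hj⟩ 1 := by
  ext p q
  simp only [stdUnit, Matrix.of_apply, Matrix.single_apply, Fin.ext_iff, eq_comm]

theorem stdUnit_of_le_left {m i j : ℕ} (hi : m ≤ i) : stdUnit m i j = 0 := by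
  ext p q
  simp only [stdUnit, Matrix.of_apply, Matrix.zero_apply]
  rw [if_neg (by omega)]

theorem stdUnit_of_le_right {m i j : ℕ} (hj : m ≤ j) : stdUnit m i j = 0 := by
  ext p q
  simp only [stdUnit, Matrix.of_apply, Matrix.zero_apply]
  rw [if_neg (by omega)]

theorem stdUnit_mul (m i j k l : ℕ) :
    stdUnit m i j * stdUnit m k l = if j = k ∧ j < m then stdUnit m i l else 0 := by
  rcases le_or_gt m i with hi | hi
  · simp [stdUnit_of_le_left hi]
  rcases le_or_gt m l with hl | hl
  · simp [stdUnit_of_le_right hl]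
  rcases le_or_gt m j with hj | hj
  · rw [stdUnit_of_le_right hj, zero_mul, if_neg (by omega)]
  rcases le_or_gt m k with hk | hk
  · rw [stdUnit_of_le_left hk, mul_zero, if_neg (by omega)]
  simp only [stdUnit_eq_single, hi, hj, hk, hl, and_true]
  split_ifs with h
  · subst h
    rw [Matrix.single_mul_single_same, one_mul]
  · exact Matrix.single_mul_single_of_ne _ _ _ _ (by simpa [Fin.ext_iff] using h) _

theorem stdUnit_lie (m i j k l : ℕ) : ⁅stdUnit m i j, stdUnit m k l⁆ =
    (if j = k ∧ j < m then stdUnit m i l else 0) -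
      if i = l ∧ i < m then stdUnit m k j else 0 := by
  rw [LieRing.of_associative_ring_bracket, stdUnit_mul, stdUnit_mul]
  congr 2
  exact propext ⟨fun h => ⟨h.1.symm, h.1 ▸ h.2⟩, fun h => ⟨h.1.symm, h.1 ▸ h.2⟩⟩

theorem isGL_stdUnit (m : ℕ) : IsGL m (stdUnit m) := by
  intro i hi j hj k hk l hl
  simp only [stdUnit_lie, hi, hj, and_true]

/-- The matrix size `t` is independent of `m`, as units out of range vanish: the factor `𝔤𝔩_n` needs
`t = n`, `m = n + 1`. The relations are homogeneous in each `f i`, so the scalars `c i` are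
harmless; they accommodate the factor `2` in the image of `𝐟_n`. -/
theorem isPreSerre_stdUnit (m t : ℕ) (c : ℕ → ℂ) :
    IsPreSerre m (fun i => stdUnit t i (i + 1)) (fun i => c i • stdUnit t (i + 1) i)
      (fun i => stdUnit t i i) where
  dd a _ b _ := by
    rw [stdUnit_lie, sub_eq_zero]
    split_ifs <;> simp_all
  de a _ j _ := by
    rw [stdUnit_lie]
    congr 1
    · split_ifs with h1 h2 h2
      · rw [h2]
      · exact absurd h1.1 h2
      · rw [stdUnit_of_le_left (by omega)]
      · rfl
    · split_ifs with h1 h2 h2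
      · rw [h2]
      · exact absurd h1.1 h2
      · rw [stdUnit_of_le_right (by omega)]
      · rfl
  df a _ j _ := by
    rw [lie_smul, stdUnit_lie, smul_sub]
    congr 1
    · split_ifs with h1 h2 h2
      · rw [h2]
      · exact absurd h1.1 h2
      · rw [stdUnit_of_le_left (by omega)]
      · exact smul_zero _
    · split_ifs with h1 h2 h2
      · rw [h2]
      · exact absurd h1.1 h2
      · rw [stdUnit_of_le_right (by omega), smul_zero]
      · exact smul_zero _
  ef i j _ _ hij := by
    rw [lie_smul, stdUnit_lie, if_neg (by omega), if_neg (by omega), sub_zero, smul_zero]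
  ee i j hij _ := by
    rw [stdUnit_lie, if_neg (by omega), if_neg (by omega), sub_zero]
  ff i j hij _ := by
    rw [lie_smul, smul_lie, stdUnit_lie, if_neg (by omega), if_neg (by omega), sub_zero,
      smul_zero, smul_zero]
  e_e_succ i _ := by
    rw [stdUnit_lie t i (i + 1) (i + 1), if_neg (show ¬(i = i + 1 + 1 ∧ i < t) by omega), sub_zero]
    split_ifs
    · rw [stdUnit_lie, if_neg (by omega), if_neg (by omega), sub_zero]
    · exact lie_zero _
  e_succ_e i _ := by
    rw [stdUnit_lie t (i + 1) (i + 1 + 1) i,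
      if_neg (show ¬(i + 1 + 1 = i ∧ i + 1 + 1 < t) by omega),
      zero_sub]
    split_ifs
    · rw [lie_neg, stdUnit_lie, if_neg (by omega), if_neg (by omega), sub_zero, neg_zero]
    · rw [neg_zero, lie_zero]
  f_f_succ i _ := by
    simp only [lie_smul, smul_lie]
    rw [stdUnit_lie t (i + 1) i, if_neg (show ¬(i = i + 1 + 1 ∧ i < t) by omega), zero_sub]
    split_ifs
    · rw [lie_neg, stdUnit_lie, if_neg (by omega), if_neg (by omega), sub_zero, neg_zero]
      simp only [smul_zero]
    · simp only [neg_zero, lie_zero, smul_zero]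
  f_succ_f i _ := by
    simp only [lie_smul, smul_lie]
    rw [stdUnit_lie t (i + 1 + 1) (i + 1) (i + 1),
      if_neg (show ¬(i + 1 + 1 = i ∧ i + 1 + 1 < t) by omega),
      sub_zero]
    split_ifs
    · rw [stdUnit_lie, if_neg (by omega), if_neg (by omega), sub_zero]
      simp only [smul_zero]
    · simp only [lie_zero, smul_zero]

/-- The linear map that sends the matrix units to the elements `P i j`. -/
def unitMap (m : ℕ) (P : ℕ → ℕ → L) : Matrix (Fin m) (Fin m) ℂ →ₗ[ℂ] L where
  toFun X := ∑ i, ∑ j, X i j • P i j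
  map_add' X Y := by simp only [Matrix.add_apply, add_smul, Finset.sum_add_distrib]
  map_smul' c X := by
    simp only [Matrix.smul_apply, smul_assoc, Finset.smul_sum, RingHom.id_apply]

theorem unitMap_apply (m : ℕ) (P : ℕ → ℕ → L) (X : Matrix (Fin m) (Fin m) ℂ) :
    unitMap m P X = ∑ i : Fin m, ∑ j : Fin m, X i j • P i j := rfl

theorem unitMap_stdUnit {m : ℕ} (P : ℕ → ℕ → L) {i j : ℕ} (hi : i < m) (hj : j < m) :
    unitMap m P (stdUnit m i j) = P i j := by
  rw [unitMap_apply, stdUnit_eq_single hi hj, Finset.sum_eq_single ⟨i, hi⟩,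
    Finset.sum_eq_single ⟨j, hj⟩]
  · simp
  · intro q _ hq
    rw [Matrix.single_apply_of_col_ne _ _ hq.symm, zero_smul]
  · simp
  · intro p _ hp
    refine Finset.sum_eq_zero fun q _ => ?_
    rw [Matrix.single_apply_of_row_ne hp.symm, zero_smul]
  · simp

theorem unitMap_lie {m : ℕ} {P : ℕ → ℕ → L} (hP : IsGL m P) (X Y : Matrix (Fin m) (Fin m) ℂ) :
    unitMap m P ⁅X, Y⁆ = ⁅unitMap m P X, unitMap m P Y⁆ := by
  have h : ∀ i j k l : Fin m, ⁅P i j, P k l⁆ =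
      (if j = k then P i l else 0) - if i = l then P k j else 0 := by
    intro i j k l
    simp only [hP i i.2 j j.2 k k.2 l l.2, Fin.ext_iff]
  have hmul : ∀ X Y : Matrix (Fin m) (Fin m) ℂ, unitMap m P (X * Y) =
      ∑ i : Fin m, ∑ j : Fin m, ∑ l : Fin m, (X i j * Y j l) • P i l := by
    intro X Y
    simp only [unitMap_apply, Matrix.mul_apply, Finset.sum_smul]
    exact Finset.sum_congr rfl fun i _ => Finset.sum_comm
  rw [LieRing.of_associative_ring_bracket, map_sub, hmul, hmul]
  simp only [unitMap_apply, sum_lie, lie_sum, smul_lie, lie_smul, h, smul_sub,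
    Finset.sum_sub_distrib, smul_ite, smul_zero]
  congr 1
  · rw [Finset.sum_comm]
    refine Finset.sum_congr rfl fun j _ => ?_
    rw [Finset.sum_comm]
    refine Finset.sum_congr rfl fun l _ => ?_
    rw [Finset.smul_sum]
    refine Finset.sum_congr rfl fun i _ => ?_
    rw [Finset.sum_ite_eq', if_pos (Finset.mem_univ _), smul_smul, mul_comm]
  · refine Finset.sum_congr rfl fun i _ => Finset.sum_congr rfl fun j _ => ?_
    rw [Finset.sum_comm, Finset.smul_sum]
    refine Finset.sum_congr rfl fun l _ => ?_
    rw [Finset.sum_ite_eq', if_pos (Finset.mem_univ _), smul_smul]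

theorem sum_stdUnit {m : ℕ} (X : Matrix (Fin m) (Fin m) ℂ) :
    X = ∑ i : Fin m, ∑ j : Fin m, X i j • stdUnit m i j := by
  conv_lhs => rw [Matrix.matrix_eq_sum_single X]
  simp [stdUnit_eq_single]

/-- The standard matrix units of the first factor of `𝔤𝔩_m × 𝔤𝔩_k`. -/
def leftUnit (m k i j : ℕ) : Matrix (Fin m) (Fin m) ℂ × Matrix (Fin k) (Fin k) ℂ :=
  (stdUnit m i j, 0)

/-- The standard matrix units of the second factor of `𝔤𝔩_m × 𝔤𝔩_k`. -/
def rightUnit (m k i j : ℕ) : Matrix (Fin m) (Fin m) ℂ × Matrix (Fin k) (Fin k) ℂ :=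
  (0, stdUnit k i j)

theorem isGL_leftUnit (m k : ℕ) : IsGL m (leftUnit m k) := by
  intro i hi j hj p hp q hq
  refine Prod.ext ?_ ?_
  · rw [LieAlgebra.Prod.bracket_apply]
    refine (isGL_stdUnit m i hi j hj p hp q hq).trans ?_
    split_ifs <;> simp [leftUnit]
  · rw [LieAlgebra.Prod.bracket_apply]
    split_ifs <;> simp [leftUnit]

theorem isGL_rightUnit (m k : ℕ) : IsGL k (rightUnit m k) := by
  intro i hi j hj p hp q hq
  refine Prod.ext ?_ ?_
  · rw [LieAlgebra.Prod.bracket_apply]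
    split_ifs <;> simp [rightUnit]
  · rw [LieAlgebra.Prod.bracket_apply]
    refine (isGL_stdUnit k i hi j hj p hp q hq).trans ?_
    split_ifs <;> simp [rightUnit]

theorem mem_of_units {m k : ℕ}
    (S : LieSubalgebra ℂ (Matrix (Fin m) (Fin m) ℂ × Matrix (Fin k) (Fin k) ℂ))
    (hl : ∀ i < m, ∀ j < m, leftUnit m k i j ∈ S) (hr : ∀ i < k, ∀ j < k, rightUnit m k i j ∈ S)
    (x : Matrix (Fin m) (Fin m) ℂ × Matrix (Fin k) (Fin k) ℂ) : x ∈ S := by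
  have hx : x = ∑ i : Fin m, ∑ j : Fin m, x.1 i j • leftUnit m k i j +
      ∑ i : Fin k, ∑ j : Fin k, x.2 i j • rightUnit m k i j := by
    refine Prod.ext ?_ ?_
    · simpa [Prod.fst_sum, leftUnit, rightUnit] using sum_stdUnit x.1
    · simpa [Prod.snd_sum, leftUnit, rightUnit] using sum_stdUnit x.2
  rw [hx]
  exact add_mem (sum_mem fun i _ => sum_mem fun j _ => S.smul_mem _ (hl i i.2 j j.2))
    (sum_mem fun i _ => sum_mem fun j _ => S.smul_mem _ (hr i i.2 j j.2))

/-- The Lie algebra homomorphism from `𝔤𝔩_m × 𝔤𝔩_k` given by two commuting systems of matrix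
units. -/
def splitHom {m k : ℕ} {Q R : ℕ → ℕ → L} (hQ : IsGL m Q) (hR : IsGL k R)
    (h : ∀ i < m, ∀ j < m, ∀ p < k, ∀ q < k, ⁅Q i j, R p q⁆ = 0) :
    Matrix (Fin m) (Fin m) ℂ × Matrix (Fin k) (Fin k) ℂ →ₗ⁅ℂ⁆ L :=
  { (unitMap m Q).coprod (unitMap k R) with
    map_lie' := by
      intro x y
      have hc : ∀ X Y, ⁅unitMap m Q X, unitMap k R Y⁆ = 0 := by
        intro X Y
        simp only [unitMap_apply, sum_lie, lie_sum, smul_lie, lie_smul]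
        refine Finset.sum_eq_zero fun p _ => Finset.sum_eq_zero fun q _ => ?_
        rw [Finset.sum_eq_zero, smul_zero]
        refine fun i _ => Finset.sum_eq_zero fun j _ => ?_
        rw [h i i.2 j j.2 p p.2 q q.2, smul_zero]
      change unitMap m Q ⁅x.1, y.1⁆ + unitMap k R ⁅x.2, y.2⁆ =
        ⁅unitMap m Q x.1 + unitMap k R x.2, unitMap m Q y.1 + unitMap k R y.2⁆
      rw [unitMap_lie hQ, unitMap_lie hR, lie_add, add_lie, add_lie, hc,
        ← lie_skew (unitMap k R x.2) (unitMap m Q y.1), hc, neg_zero, add_zero, zero_add] }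

theorem splitHom_apply {m k : ℕ} {Q R : ℕ → ℕ → L} (hQ : IsGL m Q) (hR : IsGL k R)
    (h : ∀ i < m, ∀ j < m, ∀ p < k, ∀ q < k, ⁅Q i j, R p q⁆ = 0)
    (x : Matrix (Fin m) (Fin m) ℂ × Matrix (Fin k) (Fin k) ℂ) :
    splitHom hQ hR h x = unitMap m Q x.1 + unitMap k R x.2 := rfl

end Matrices

/-! ### The eigenspaces of the reversal and the map `𝔤^θ → 𝔤𝔩_{n+1} × 𝔤𝔩_n` -/

section FixedPoints

variable {n : ℕ}

theorem apply_rev_rev (x : fixedSubalgebra n) (p q : Fin (2 * n + 1)) :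
    (x : MatLie n) p.rev q.rev = (x : MatLie n) p q := by
  have h : theta n x = x := x.2
  conv_rhs => rw [← h]
  rfl

theorem idx_last_rev : (idx n (Fin.last n)).rev = idx n (Fin.last n) := by
  ext
  simp only [idx, Fin.val_rev, Fin.val_castLE, Fin.val_last]
  omega

/-- Groups the indices into orbits of the reversal: `n` pairs and the fixed middle one. -/
theorem sum_eq_sum_idx {V : Type*} [AddCommMonoid V] (g : Fin (2 * n + 1) → V) :
    ∑ p, g p = ∑ i : Fin n, (g (idx n i.castSucc) + g (idx n i.castSucc).rev) +
      g (idx n (Fin.last n)) := by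
  let G : ℕ → V := fun k => if h : k < 2 * n + 1 then g ⟨k, h⟩ else 0
  have h1 : ∀ p : Fin (2 * n + 1), g p = G p := fun p => by
    simp only [G, dif_pos p.isLt]
  simp only [h1, idx, Fin.val_rev, Fin.val_castLE, Fin.val_castSucc, Fin.val_last,
    Finset.sum_add_distrib]
  rw [Fin.sum_univ_eq_sum_range G (2 * n + 1), Fin.sum_univ_eq_sum_range G n,
    Fin.sum_univ_eq_sum_range (fun k => G (2 * n + 1 - (k + 1))) n,
    show 2 * n + 1 = (n + 1) + n by omega, Finset.sum_range_add, Finset.sum_range_succ,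
    ← Finset.sum_range_reflect (fun k => G (n + 1 + k))]
  have h2 : ∀ k ∈ Finset.range n, G (n + 1 + (n - 1 - k)) = G (n + 1 + n - (k + 1)) := by
    intro k hk
    have := Finset.mem_range.1 hk
    congr 1
    omega
  rw [Finset.sum_congr rfl h2]
  abel

/-- The matrix of `x` on the vectors fixed by the reversal of the coordinates. -/
def symBlock (n : ℕ) : MatLie n →ₗ[ℂ] Matrix (Fin (n + 1)) (Fin (n + 1)) ℂ where
  -- The basis is `v_j + v_{rev j}` for `j < n` and the middle `v_n`, taken once; hence the middle
  -- column is not doubled. This is the source of the factor `2` in the image of `𝐟_n`.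
  toFun x := Matrix.of fun i j =>
    x (idx n i) (idx n j) + if j = Fin.last n then 0 else x (idx n i) (idx n j).rev
  map_add' x y := by
    ext i j
    simp only [Matrix.of_apply, Matrix.add_apply]
    split_ifs <;> ring
  map_smul' c x := by
    ext i j
    simp only [Matrix.of_apply, Matrix.smul_apply, RingHom.id_apply, smul_eq_mul]
    split_ifs <;> ring

theorem symBlock_apply (x : MatLie n) (i j : Fin (n + 1)) : symBlock n x i j =
    x (idx n i) (idx n j) + if j = Fin.last n then 0 else x (idx n i) (idx n j).rev := rfl

/-- The matrix of `x` on the vectors negated by the reversal of the coordinates. -/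
def antiBlock (n : ℕ) : MatLie n →ₗ[ℂ] Matrix (Fin n) (Fin n) ℂ where
  toFun x := Matrix.of fun i j =>
    x (idx n i.castSucc) (idx n j.castSucc) - x (idx n i.castSucc) (idx n j.castSucc).rev
  map_add' x y := by
    ext i j
    simp only [Matrix.of_apply, Matrix.add_apply]
    ring
  map_smul' c x := by
    ext i j
    simp only [Matrix.of_apply, Matrix.smul_apply, RingHom.id_apply, smul_eq_mul]
    ring

theorem antiBlock_apply (x : MatLie n) (i j : Fin n) : antiBlock n x i j =
    x (idx n i.castSucc) (idx n j.castSucc) - x (idx n i.castSucc) (idx n j.castSucc).rev := rfl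

/-- `y` maps symmetric vectors to symmetric vectors, and such a vector is determined by its first `n
+ 1` coordinates. `antiBlock_mul` is the same for antisymmetric vectors, whose middle coordinate is
`0`. -/
theorem symBlock_mul (x y : MatLie n) (hy : ∀ p q, y p.rev q.rev = y p q) :
    symBlock n (x * y) = symBlock n x * symBlock n y := by
  ext i j
  have hz : ∀ p, (y p.rev (idx n j) + if j = Fin.last n then 0 else y p.rev (idx n j).rev) =
      y p (idx n j) + if j = Fin.last n then 0 else y p (idx n j).rev := by
    intro p
    split_ifs with h
    · subst h
      rw [← idx_last_rev, hy, idx_last_rev]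
    · rw [hy, ← hy p.rev, Fin.rev_rev, add_comm]
  have h1 : symBlock n (x * y) i j = ∑ p, x (idx n i) p *
      (y p (idx n j) + if j = Fin.last n then 0 else y p (idx n j).rev) := by
    rw [symBlock_apply, Matrix.mul_apply, Matrix.mul_apply]
    split_ifs
    · simp only [add_zero]
    · rw [← Finset.sum_add_distrib]
      exact Finset.sum_congr rfl fun p _ => (mul_add _ _ _).symm
  rw [h1, sum_eq_sum_idx, Matrix.mul_apply, Fin.sum_univ_castSucc]
  simp only [symBlock_apply, hz, if_true, add_zero, ← add_mul, (Fin.castSucc_lt_last _).ne,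
    if_false]

theorem antiBlock_mul (x y : MatLie n) (hy : ∀ p q, y p.rev q.rev = y p q) :
    antiBlock n (x * y) = antiBlock n x * antiBlock n y := by
  ext i j
  have hz : ∀ p, y p.rev (idx n j.castSucc) - y p.rev (idx n j.castSucc).rev =
      -(y p (idx n j.castSucc) - y p (idx n j.castSucc).rev) := by
    intro p
    rw [hy, ← hy p.rev, Fin.rev_rev, neg_sub]
  have hz0 : y (idx n (Fin.last n)) (idx n j.castSucc) -
      y (idx n (Fin.last n)) (idx n j.castSucc).rev = 0 := by
    rw [← hy _ (idx n j.castSucc).rev, Fin.rev_rev, idx_last_rev, sub_self]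
  have h1 : antiBlock n (x * y) i j = ∑ p, x (idx n i.castSucc) p *
      (y p (idx n j.castSucc) - y p (idx n j.castSucc).rev) := by
    rw [antiBlock_apply, Matrix.mul_apply, Matrix.mul_apply, ← Finset.sum_sub_distrib]
    exact Finset.sum_congr rfl fun p _ => (mul_sub _ _ _).symm
  rw [h1, sum_eq_sum_idx, Matrix.mul_apply, hz0, mul_zero, add_zero]
  refine Finset.sum_congr rfl fun k _ => ?_
  rw [hz, antiBlock_apply, antiBlock_apply]
  ring

/-- The decomposition `𝔤^θ → 𝔤𝔩_{n+1} × 𝔤𝔩_n`. -/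
def blocks (n : ℕ) : fixedSubalgebra n →ₗ⁅ℂ⁆
    Matrix (Fin (n + 1)) (Fin (n + 1)) ℂ × Matrix (Fin n) (Fin n) ℂ :=
  { ((symBlock n).prod (antiBlock n)).comp (fixedSubalgebra n).subtype with
    map_lie' := by
      intro x y
      have hx := apply_rev_rev x
      have hy := apply_rev_rev y
      refine Prod.ext ?_ ?_
      · change symBlock n ((x : MatLie n) * y - (y : MatLie n) * x) =
          symBlock n x * symBlock n y - symBlock n y * symBlock n x
        rw [map_sub, symBlock_mul _ _ hx, symBlock_mul _ _ hy]
      · change antiBlock n ((x : MatLie n) * y - (y : MatLie n) * x) =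
          antiBlock n x * antiBlock n y - antiBlock n y * antiBlock n x
        rw [map_sub, antiBlock_mul _ _ hx, antiBlock_mul _ _ hy] }

theorem idx_cases (p : Fin (2 * n + 1)) :
    p = idx n (Fin.last n) ∨ ∃ i : Fin n, p = idx n i.castSucc ∨ p = (idx n i.castSucc).rev := by
  rcases lt_trichotomy p.val n with h | h | h
  · exact Or.inr ⟨⟨p, h⟩, Or.inl rfl⟩
  · exact Or.inl (Fin.ext h)
  · refine Or.inr ⟨⟨2 * n - p, by omega⟩, Or.inr (Fin.ext ?_)⟩
    simp only [idx, Fin.val_rev, Fin.val_castLE, Fin.val_castSucc]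
    omega

/-- The two blocks contain the sums and the differences of mirrored entries in the upper rows; the
lower rows follow by symmetry. In the middle row, mirrored entries agree, so the sums suffice. -/
theorem blocks_injective (n : ℕ) : Function.Injective (blocks n) := by
  rw [injective_iff_map_eq_zero]
  intro x hx
  have hs : ∀ i j, symBlock n (x : MatLie n) i j = 0 := fun i j =>
    congrFun (congrFun (congrArg Prod.fst hx) i) j
  have ha : ∀ i j, antiBlock n (x : MatLie n) i j = 0 := fun i j =>
    congrFun (congrFun (congrArg Prod.snd hx) i) j
  have hrow : ∀ i : Fin (n + 1), ∀ q, (x : MatLie n) (idx n i) q = 0 := by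
    intro i q
    rcases idx_cases q with rfl | ⟨j, hq⟩
    · simpa [symBlock_apply] using hs i (Fin.last n)
    have h1 := hs i j.castSucc
    rw [symBlock_apply, if_neg (Fin.castSucc_lt_last j).ne] at h1
    have h2 : (x : MatLie n) (idx n i) (idx n j.castSucc) =
        (x : MatLie n) (idx n i) (idx n j.castSucc).rev := by
      refine Fin.lastCases ?_ (fun i => ?_) i
      · rw [← apply_rev_rev, idx_last_rev]
      · exact sub_eq_zero.1 (ha i j)
    have h3 : (x : MatLie n) (idx n i) (idx n j.castSucc) = 0 := by
      rw [← h2, ← two_mul] at h1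
      exact (mul_eq_zero.1 h1).resolve_left two_ne_zero
    rcases hq with rfl | rfl
    · exact h3
    · rw [← h2, h3]
  refine Subtype.ext (Matrix.ext fun p q => ?_)
  rcases idx_cases p with rfl | ⟨i, rfl | rfl⟩
  · exact hrow _ q
  · exact hrow _ q
  · rw [← apply_rev_rev, Fin.rev_rev]
    exact hrow _ _

end FixedPoints

/-! ### The generators inside `𝔤𝔩_{n+1} × 𝔤𝔩_n` -/

section Generators

/-- The relations between the Chevalley generators of the fixed-point subalgebra. The element
`d n` is half of the generator `𝐝_{n + 1}`. -/
structure IsFixedSerre {L : Type*} [LieRing L] [LieAlgebra ℂ L] (n : ℕ) (e f d : ℕ → L) :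
    Prop where
  pre : IsPreSerre (n + 1) e f d
  ef_diag : ∀ i, i + 1 < n → ⁅e i, f i⁆ = d i - d (i + 1)
  efe : ∀ i, i + 1 = n → ⁅⁅e i, f i⁆, e i⁆ = (4 : ℂ) • e i
  fef : ∀ i, i + 1 = n → ⁅⁅f i, e i⁆, f i⁆ = (4 : ℂ) • f i

/-- The Lie algebra `𝔤𝔩_{n+1} × 𝔤𝔩_n`. -/
abbrev Blocks (n : ℕ) : Type :=
  Matrix (Fin (n + 1)) (Fin (n + 1)) ℂ × Matrix (Fin n) (Fin n) ℂ

/-- The image of `𝐞_i` in `𝔤𝔩_{n+1} × 𝔤𝔩_n`. -/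
def eBlocks (n i : ℕ) : Blocks n := (stdUnit (n + 1) i (i + 1), stdUnit n i (i + 1))

/-- The image of `𝐟_i` in `𝔤𝔩_{n+1} × 𝔤𝔩_n`. -/
def fBlocks (n i : ℕ) : Blocks n :=
  ((if i + 1 = n then (2 : ℂ) else 1) • stdUnit (n + 1) (i + 1) i, stdUnit n (i + 1) i)

/-- The image of `𝐝_i`, or of its half when `i = n + 1`, in `𝔤𝔩_{n+1} × 𝔤𝔩_n`. -/
def dBlocks (n i : ℕ) : Blocks n := (stdUnit (n + 1) i i, stdUnit n i i)

theorem IsPreSerre.of_fst_snd {L₁ L₂ : Type*} [LieRing L₁] [LieRing L₂] {m : ℕ}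
    {e f d : ℕ → L₁ × L₂} (h1 : IsPreSerre m (fun i => (e i).1) (fun i => (f i).1) fun i => (d i).1)
    (h2 : IsPreSerre m (fun i => (e i).2) (fun i => (f i).2) fun i => (d i).2) :
    IsPreSerre m e f d where
  dd a ha b hb := Prod.ext (h1.dd a ha b hb) (h2.dd a ha b hb)
  de a ha j hj := Prod.ext
    ((h1.de a ha j hj).trans (by simp only [apply_ite Prod.fst, Prod.fst_sub, Prod.fst_zero]))
    ((h2.de a ha j hj).trans (by simp only [apply_ite Prod.snd, Prod.snd_sub, Prod.snd_zero]))
  df a ha j hj := Prod.ext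
    ((h1.df a ha j hj).trans (by simp only [apply_ite Prod.fst, Prod.fst_sub, Prod.fst_zero]))
    ((h2.df a ha j hj).trans (by simp only [apply_ite Prod.snd, Prod.snd_sub, Prod.snd_zero]))
  ef i j hi hj hij := Prod.ext (h1.ef i j hi hj hij) (h2.ef i j hi hj hij)
  ee i j hij hj := Prod.ext (h1.ee i j hij hj) (h2.ee i j hij hj)
  ff i j hij hj := Prod.ext (h1.ff i j hij hj) (h2.ff i j hij hj)
  e_e_succ i hi := Prod.ext (h1.e_e_succ i hi) (h2.e_e_succ i hi)
  e_succ_e i hi := Prod.ext (h1.e_succ_e i hi) (h2.e_succ_e i hi)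
  f_f_succ i hi := Prod.ext (h1.f_f_succ i hi) (h2.f_f_succ i hi)
  f_succ_f i hi := Prod.ext (h1.f_succ_f i hi) (h2.f_succ_f i hi)

theorem isFixedSerre_blocks (n : ℕ) :
    IsFixedSerre n (eBlocks n) (fBlocks n) (dBlocks n) where
  pre := by
    refine IsPreSerre.of_fst_snd (isPreSerre_stdUnit (n + 1) (n + 1) _) ?_
    -- In the second factor the last `e`, `f`, `d` are out of range, hence `0`.
    have h := isPreSerre_stdUnit (n + 1) n fun _ => 1
    simp only [one_smul] at h
    exact h
  ef_diag i hi := by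
    refine Prod.ext ?_ ?_
    · change ⁅stdUnit (n + 1) i (i + 1), _ • stdUnit (n + 1) (i + 1) i⁆ =
        stdUnit (n + 1) i i - stdUnit (n + 1) (i + 1) (i + 1)
      rw [if_neg (by omega), one_smul, stdUnit_lie, if_pos (by omega), if_pos (by omega)]
    · change ⁅stdUnit n i (i + 1), stdUnit n (i + 1) i⁆ =
        stdUnit n i i - stdUnit n (i + 1) (i + 1)
      rw [stdUnit_lie, if_pos (by omega), if_pos (by omega)]
  efe i hi := by
    refine Prod.ext ?_ ?_
    · change ⁅⁅stdUnit (n + 1) i (i + 1), _ • stdUnit (n + 1) (i + 1) i⁆,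
        stdUnit (n + 1) i (i + 1)⁆ = (4 : ℂ) • stdUnit (n + 1) i (i + 1)
      rw [if_pos hi, lie_smul, smul_lie, stdUnit_lie, if_pos (by omega), if_pos (by omega),
        sub_lie, stdUnit_lie, stdUnit_lie, if_pos (by omega), if_neg (by omega),
        if_neg (by omega), if_pos (by omega)]
      module
    · change ⁅⁅stdUnit n i (i + 1), _⁆, stdUnit n i (i + 1)⁆ = (4 : ℂ) • stdUnit n i (i + 1)
      rw [stdUnit_of_le_right (by omega), lie_zero, smul_zero]
  fef i hi := by
    refine Prod.ext ?_ ?_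
    · change ⁅⁅_ • stdUnit (n + 1) (i + 1) i, stdUnit (n + 1) i (i + 1)⁆,
        _ • stdUnit (n + 1) (i + 1) i⁆ = (4 : ℂ) • _ • stdUnit (n + 1) (i + 1) i
      rw [if_pos hi, smul_lie, smul_lie, lie_smul, stdUnit_lie, if_pos (by omega),
        if_pos (by omega), sub_lie, stdUnit_lie, stdUnit_lie, if_pos (by omega),
        if_neg (by omega), if_neg (by omega), if_pos (by omega)]
      module
    · change ⁅⁅stdUnit n (i + 1) i, _⁆, stdUnit n (i + 1) i⁆ = (4 : ℂ) • stdUnit n (i + 1) i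
      rw [stdUnit_of_le_left (by omega), lie_zero, smul_zero]

theorem isSplitting_blocks (n : ℕ) : IsSplitting n (leftUnit (n + 1) n) (rightUnit (n + 1) n)
    (eBlocks n) (fBlocks n) (dBlocks n) where
  left := isGL_leftUnit _ _
  right := isGL_rightUnit _ _
  comm i _ j _ k _ l _ := by
    refine Prod.ext ?_ ?_
    · exact lie_zero (stdUnit (n + 1) i j)
    · exact zero_lie (stdUnit n k l)
  diag i _ := by simp [dBlocks, leftUnit, rightUnit]
  diag_last := by simp [dBlocks, leftUnit, stdUnit_of_le_left]
  upper i _ := by simp [eBlocks, leftUnit, rightUnit]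
  lower i hi := by simp [fBlocks, leftUnit, rightUnit, hi.ne]
  upper_last i hi := by
    simp [eBlocks, leftUnit, stdUnit_of_le_right, hi]
  lower_last i hi := by
    simp [fBlocks, leftUnit, stdUnit_of_le_left, hi]

/-- The last `e`, `f`, `d` lie in the first system alone. From there one descends: a bracket with `Q
(i + 1) (i + 1)` removes the `R`-part of `e i` and `f i`, and the bracket of the resulting `Q i (i +
1)` and `Q (i + 1) i` yields `Q i i`. Once `Q` is obtained, `R` follows by subtraction. -/
theorem IsSplitting.mem {L : Type*} [LieRing L] [LieAlgebra ℂ L] {n : ℕ} {Q R : ℕ → ℕ → L}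
    {e f d : ℕ → L} (h : IsSplitting n Q R e f d) (S : LieSubalgebra ℂ L)
    (he : ∀ i < n, e i ∈ S) (hf : ∀ i < n, f i ∈ S) (hd : ∀ i ≤ n, d i ∈ S) :
    (∀ i < n + 1, ∀ j < n + 1, Q i j ∈ S) ∧ ∀ i < n, ∀ j < n, R i j ∈ S := by
  have comm' : ∀ i < n + 1, ∀ j < n + 1, ∀ k < n, ∀ l < n, ⁅R k l, Q i j⁆ = 0 := by
    intro i hi j hj k hk l hl
    rw [← lie_skew, h.comm i hi j hj k hk l hl, neg_zero]
  have off : ∀ i < n, Q (i + 1) (i + 1) ∈ S → Q i (i + 1) ∈ S ∧ Q (i + 1) i ∈ S := by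
    intro i hi hQ
    rcases Nat.lt_or_eq_of_le (Nat.succ_le_of_lt hi) with hin | hin
    · constructor
      · have h1 := S.lie_mem (he i hi) hQ
        rwa [h.upper i hin, add_lie, comm' _ (by omega) _ (by omega) _ hi _ hin, add_zero,
          h.left i (by omega) _ (by omega) _ (by omega) _ (by omega), if_pos rfl,
          if_neg (by omega), sub_zero] at h1
      · have h1 := S.lie_mem hQ (hf i hi)
        rwa [h.lower i hin, lie_add, h.comm _ (by omega) _ (by omega) _ hin _ hi, add_zero,
          h.left _ (by omega) _ (by omega) _ (by omega) _ (by omega), if_pos rfl,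
          if_neg (by omega), sub_zero] at h1
    · constructor
      · have h1 := he i hi
        rw [h.upper_last i hin] at h1
        rwa [show i + 1 = n from hin]
      · have h1 := S.smul_mem (1 / 2 : ℂ) (hf i hi)
        rw [h.lower_last i hin, smul_smul, show (1 / 2 * 2 : ℂ) = 1 by norm_num, one_smul] at h1
        rwa [show i + 1 = n from hin]
  have diag : ∀ i ≤ n, Q i i ∈ S := by
    intro i hi
    induction hi using Nat.decreasingInduction with
    | self => exact h.diag_last ▸ hd n le_rfl
    | of_succ i hi ih =>
      have h1 := S.lie_mem (off i hi ih).1 (off i hi ih).2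
      rw [h.left i (by omega) _ (by omega) _ (by omega) _ (by omega), if_pos rfl, if_pos rfl] at h1
      simpa using S.add_mem h1 ih
  have hQ : ∀ i < n + 1, ∀ j < n + 1, Q i j ∈ S := fun i hi j hj =>
    h.left.induction (· ∈ S) (fun _ _ => S.lie_mem) (fun i hi => diag i (by omega))
      (fun i hi => (off i (by omega) (diag _ (by omega))).1)
      (fun i hi => (off i (by omega) (diag _ (by omega))).2) hi hj
  refine ⟨hQ, fun i hi j hj => h.right.induction (· ∈ S) (fun _ _ => S.lie_mem)
    (fun i hi => ?_) (fun i hi => ?_) (fun i hi => ?_) hi hj⟩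
  · have h1 := S.sub_mem (hd i hi.le) (hQ i (by omega) i (by omega))
    rwa [h.diag i hi, add_sub_cancel_left] at h1
  · have h1 := S.sub_mem (he i (by omega)) (hQ i (by omega) (i + 1) (by omega))
    rwa [h.upper i hi, add_sub_cancel_left] at h1
  · have h1 := S.sub_mem (hf i (by omega)) (hQ (i + 1) (by omega) i (by omega))
    rwa [h.lower i hi, add_sub_cancel_left] at h1

theorem eFix_apply {n : ℕ} (i : Fin n) (p q : Fin (2 * n + 1)) :
    (eFix n i : MatLie n) p q = (if p.val = i ∧ q.val = i + 1 then 1 else 0) +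
      if p.val = 2 * n - i ∧ q.val = 2 * n - (i + 1) then 1 else 0 := by
  change (E n (vtx n i) + F n (tau n (vtx n i))) p q = _
  simp only [E, F, tau, vtx, Matrix.add_apply, Matrix.single_apply, Fin.ext_iff, Fin.val_succ,
    Fin.val_castSucc, Fin.val_rev, Fin.val_castLE]
  congr 1 <;> congr 1 <;> apply propext <;> omega

theorem fFix_apply {n : ℕ} (i : Fin n) (p q : Fin (2 * n + 1)) :
    (fFix n i : MatLie n) p q = (if p.val = i + 1 ∧ q.val = i then 1 else 0) +
      if p.val = 2 * n - (i + 1) ∧ q.val = 2 * n - i then 1 else 0 := by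
  change (F n (vtx n i) + E n (tau n (vtx n i))) p q = _
  simp only [E, F, tau, vtx, Matrix.add_apply, Matrix.single_apply, Fin.ext_iff, Fin.val_succ,
    Fin.val_castSucc, Fin.val_rev, Fin.val_castLE]
  congr 1 <;> congr 1 <;> apply propext <;> omega

theorem dFix_apply {n : ℕ} (i : Fin (n + 1)) (p q : Fin (2 * n + 1)) :
    (dFix n i : MatLie n) p q = (if p.val = i ∧ q.val = i then 1 else 0) +
      if p.val = 2 * n - i ∧ q.val = 2 * n - i then 1 else 0 := by
  change (H n (idx n i) + H n (idx n i).rev) p q = _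
  simp only [H, idx, Matrix.add_apply, Matrix.single_apply, Fin.ext_iff, Fin.val_rev,
    Fin.val_castLE]
  congr 1 <;> congr 1 <;> apply propext <;> omega

theorem blocks_eFix {n : ℕ} (i : Fin n) : blocks n (eFix n i) = eBlocks n i := by
  refine Prod.ext (Matrix.ext fun a b => ?_) (Matrix.ext fun a b => ?_)
  · change symBlock n (eFix n i : MatLie n) a b = stdUnit (n + 1) i (i + 1) a b
    simp only [symBlock_apply, eFix_apply, stdUnit, Matrix.of_apply, idx, Fin.val_castLE,
      Fin.val_rev, Fin.ext_iff, Fin.val_last]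
    split_ifs <;> first | (exfalso; omega) | norm_num
  · change antiBlock n (eFix n i : MatLie n) a b = stdUnit n i (i + 1) a b
    simp only [antiBlock_apply, eFix_apply, stdUnit, Matrix.of_apply, idx, Fin.val_castLE,
      Fin.val_rev, Fin.val_castSucc]
    split_ifs <;> first | (exfalso; omega) | norm_num

theorem blocks_fFix {n : ℕ} (i : Fin n) : blocks n (fFix n i) = fBlocks n i := by
  refine Prod.ext (Matrix.ext fun a b => ?_) (Matrix.ext fun a b => ?_)
  · change symBlock n (fFix n i : MatLie n) a b =
      (if i.val + 1 = n then (2 : ℂ) else 1) * stdUnit (n + 1) (i + 1) i a b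
    simp only [symBlock_apply, fFix_apply, stdUnit, Matrix.of_apply, idx, Fin.val_castLE,
      Fin.val_rev, Fin.ext_iff, Fin.val_last]
    split_ifs <;> first | (exfalso; omega) | norm_num
  · change antiBlock n (fFix n i : MatLie n) a b = stdUnit n (i + 1) i a b
    simp only [antiBlock_apply, fFix_apply, stdUnit, Matrix.of_apply, idx, Fin.val_castLE,
      Fin.val_rev, Fin.val_castSucc]
    split_ifs <;> first | (exfalso; omega) | norm_num

theorem blocks_dFix {n : ℕ} (i : Fin (n + 1)) :
    blocks n (dFix n i) = (if i.val = n then (2 : ℂ) else 1) • dBlocks n i := by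
  refine Prod.ext (Matrix.ext fun a b => ?_) (Matrix.ext fun a b => ?_)
  · change symBlock n (dFix n i : MatLie n) a b =
      (if i.val = n then (2 : ℂ) else 1) * stdUnit (n + 1) i i a b
    simp only [symBlock_apply, dFix_apply, stdUnit, Matrix.of_apply, idx, Fin.val_castLE,
      Fin.val_rev, Fin.ext_iff, Fin.val_last]
    split_ifs <;> first | (exfalso; omega) | norm_num
  · change antiBlock n (dFix n i : MatLie n) a b =
      (if i.val = n then (2 : ℂ) else 1) * stdUnit n i i a b
    simp only [antiBlock_apply, dFix_apply, stdUnit, Matrix.of_apply, idx, Fin.val_castLE,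
      Fin.val_rev, Fin.val_castSucc]
    split_ifs <;> first | (exfalso; omega) | norm_num

end Generators

/-! ### Defining relations as Lie relations -/

section Presentation

theorem IsFixedSerre.map {L L' : Type*} [LieRing L] [LieAlgebra ℂ L] [LieRing L']
    [LieAlgebra ℂ L'] {n : ℕ} {e f d : ℕ → L} (h : IsFixedSerre n e f d) (φ : L →ₗ⁅ℂ⁆ L') :
    IsFixedSerre n (fun i => φ (e i)) (fun i => φ (f i)) fun i => φ (d i) where
  pre :=
    { dd := fun a ha b hb => by rw [← φ.map_lie, h.pre.dd a ha b hb, map_zero]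
      de := fun a ha j hj => by
        rw [← φ.map_lie, h.pre.de a ha j hj, map_sub, apply_ite φ, apply_ite φ, map_zero]
      df := fun a ha j hj => by
        rw [← φ.map_lie, h.pre.df a ha j hj, map_sub, apply_ite φ, apply_ite φ, map_zero]
      ef := fun i j hi hj hij => by rw [← φ.map_lie, h.pre.ef i j hi hj hij, map_zero]
      ee := fun i j hij hj => by rw [← φ.map_lie, h.pre.ee i j hij hj, map_zero]
      ff := fun i j hij hj => by rw [← φ.map_lie, h.pre.ff i j hij hj, map_zero]
      e_e_succ := fun i hi => by
        rw [← φ.map_lie, ← φ.map_lie, h.pre.e_e_succ i hi, map_zero]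
      e_succ_e := fun i hi => by
        rw [← φ.map_lie, ← φ.map_lie, h.pre.e_succ_e i hi, map_zero]
      f_f_succ := fun i hi => by
        rw [← φ.map_lie, ← φ.map_lie, h.pre.f_f_succ i hi, map_zero]
      f_succ_f := fun i hi => by
        rw [← φ.map_lie, ← φ.map_lie, h.pre.f_succ_f i hi, map_zero] }
  ef_diag i hi := by rw [← φ.map_lie, h.ef_diag i hi, map_sub]
  efe i hi := by rw [← φ.map_lie, ← φ.map_lie, h.efe i hi, map_smul]
  fef i hi := by rw [← φ.map_lie, ← φ.map_lie, h.fef i hi, map_smul]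

theorem IsFixedSerre.of_injective {L L' : Type*} [LieRing L] [LieAlgebra ℂ L] [LieRing L']
    [LieAlgebra ℂ L'] {n : ℕ} {e f d : ℕ → L} (φ : L →ₗ⁅ℂ⁆ L') (hφ : Function.Injective φ)
    (h : IsFixedSerre n (fun i => φ (e i)) (fun i => φ (f i)) fun i => φ (d i)) :
    IsFixedSerre n e f d where
  pre :=
    { dd := fun a ha b hb => hφ (by rw [φ.map_lie, h.pre.dd a ha b hb, map_zero])
      de := fun a ha j hj => hφ (by
        rw [φ.map_lie, h.pre.de a ha j hj, map_sub, apply_ite φ, apply_ite φ, map_zero])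
      df := fun a ha j hj => hφ (by
        rw [φ.map_lie, h.pre.df a ha j hj, map_sub, apply_ite φ, apply_ite φ, map_zero])
      ef := fun i j hi hj hij => hφ (by rw [φ.map_lie, h.pre.ef i j hi hj hij, map_zero])
      ee := fun i j hij hj => hφ (by rw [φ.map_lie, h.pre.ee i j hij hj, map_zero])
      ff := fun i j hij hj => hφ (by rw [φ.map_lie, h.pre.ff i j hij hj, map_zero])
      e_e_succ := fun i hi => hφ (by
        rw [φ.map_lie, φ.map_lie, h.pre.e_e_succ i hi, map_zero])
      e_succ_e := fun i hi => hφ (by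
        rw [φ.map_lie, φ.map_lie, h.pre.e_succ_e i hi, map_zero])
      f_f_succ := fun i hi => hφ (by
        rw [φ.map_lie, φ.map_lie, h.pre.f_f_succ i hi, map_zero])
      f_succ_f := fun i hi => hφ (by
        rw [φ.map_lie, φ.map_lie, h.pre.f_succ_f i hi, map_zero]) }
  ef_diag i hi := hφ (by rw [φ.map_lie, h.ef_diag i hi, map_sub])
  efe i hi := hφ (by rw [φ.map_lie, φ.map_lie, h.efe i hi, map_smul])
  fef i hi := hφ (by rw [φ.map_lie, φ.map_lie, h.fef i hi, map_smul])

variable {n : ℕ}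

/-- The family `e` as a sequence, continued by `0`. -/
def eSeq {V : Type*} [AddCommGroup V] (g : Gen n → V) (i : ℕ) : V :=
  if h : i < n then g (.e ⟨i, h⟩) else 0

/-- The family `f` as a sequence, continued by `0`. -/
def fSeq {V : Type*} [AddCommGroup V] (g : Gen n → V) (i : ℕ) : V :=
  if h : i < n then g (.f ⟨i, h⟩) else 0

/-- The family `d` as a sequence, with its last member halved, continued by `0`. -/
def dSeq {V : Type*} [AddCommGroup V] [Module ℂ V] (g : Gen n → V) (i : ℕ) : V :=
  if h : i < n + 1 then (if i = n then (1 / 2 : ℂ) else 1) • g (.d ⟨i, h⟩) else 0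

theorem eSeq_val {V : Type*} [AddCommGroup V] (g : Gen n → V) (i : Fin n) :
    eSeq g i = g (.e i) := dif_pos i.isLt

theorem fSeq_val {V : Type*} [AddCommGroup V] (g : Gen n → V) (i : Fin n) :
    fSeq g i = g (.f i) := dif_pos i.isLt

theorem dSeq_val {V : Type*} [AddCommGroup V] [Module ℂ V] (g : Gen n → V) (a : Fin (n + 1)) :
    (if a.val = n then (2 : ℂ) else 1) • dSeq g a = g (.d a) := by
  rw [dSeq, dif_pos a.isLt, smul_smul]
  split_ifs <;> norm_num

theorem dSeq_of_lt {V : Type*} [AddCommGroup V] [Module ℂ V] (g : Gen n → V) {i : ℕ}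
    (hi : i < n) : dSeq g i = g (.d ⟨i, by omega⟩) := by
  rw [dSeq, dif_pos (by omega), if_neg hi.ne, one_smul]

section Map

variable {V W : Type*} [AddCommGroup V] [Module ℂ V] [AddCommGroup W] [Module ℂ W]

theorem map_eSeq (φ : V →ₗ[ℂ] W) (g : Gen n → V) (i : ℕ) :
    eSeq (fun x => φ (g x)) i = φ (eSeq g i) := by
  simp only [eSeq]
  split_ifs <;> simp

theorem map_fSeq (φ : V →ₗ[ℂ] W) (g : Gen n → V) (i : ℕ) :
    fSeq (fun x => φ (g x)) i = φ (fSeq g i) := by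
  simp only [fSeq]
  split_ifs <;> simp

theorem map_dSeq (φ : V →ₗ[ℂ] W) (g : Gen n → V) (i : ℕ) :
    dSeq (fun x => φ (g x)) i = φ (dSeq g i) := by
  simp only [dSeq]
  split_ifs <;> simp

end Map

section Relations

theorem serre_eq_lie_lie {A : Type*} [Ring A] (x y : A) :
    x ^ 2 * y - 2 * x * y * x + y * x ^ 2 = ⁅x, ⁅x, y⁆⁆ := by
  simp only [LieRing.of_associative_ring_bracket]
  noncomm_ring

variable {A : Type*} [Ring A] [Algebra ℂ A]

theorem neg_four_mul (x : A) : -4 * x = -((4 : ℂ) • x) := by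
  rw [Algebra.smul_def, map_ofNat, neg_mul]

/-- In this range the middle delta is nonzero only for `a = n`, `j = n - 1`, where it doubles the
first one. So the coefficients are those of `𝔤𝔩_{n+1}`, doubled at `a = n`; halving the last `d`
restores them. -/
theorem delta_eq {a j : ℕ} (ha : a ≤ n) (hj : j < n) :
    -delta (a + 1) (j + 1 + 1) - delta (2 * n + 2 - (a + 1)) (j + 1 + 1) + delta (a + 1) (j + 1) =
      (if a = n then (2 : ℂ) else 1) * ((if a = j then 1 else 0) - if a = j + 1 then 1 else 0) := by
  simp only [delta]
  split_ifs <;> first | (exfalso; omega) | norm_num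

theorem delta_eq' {a j : ℕ} (ha : a ≤ n) (hj : j < n) :
    -delta (a + 1) (j + 1) + delta (a + 1) (j + 1 + 1) + delta (2 * n + 2 - (a + 1)) (j + 1 + 1) =
      (if a = n then (2 : ℂ) else 1) * ((if a = j + 1 then 1 else 0) - if a = j then 1 else 0) := by
  simp only [delta]
  split_ifs <;> first | (exfalso; omega) | norm_num

theorem half_mul_two (a : ℕ) (c : ℂ) :
    (if a = n then (1 / 2 : ℂ) else 1) * ((if a = n then (2 : ℂ) else 1) * c) = c := by
  split_ifs <;> ring

/-- Elements which satisfy the defining relations satisfy their Lie algebra version. -/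
theorem isFixedSerre_of_rel {g : Gen n → A}
    (hg : ∀ x y, Rel n x y → FreeAlgebra.lift ℂ g x = FreeAlgebra.lift ℂ g y) :
    IsFixedSerre n (eSeq g) (fSeq g) (dSeq g) := by
  have he : ∀ i, (h : i < n) → eSeq g i = g (.e ⟨i, h⟩) := fun i h => dif_pos h
  have hf : ∀ i, (h : i < n) → fSeq g i = g (.f ⟨i, h⟩) := fun i h => dif_pos h
  have hd : ∀ i, (h : i < n + 1) →
      dSeq g i = (if i = n then (1 / 2 : ℂ) else 1) • g (.d ⟨i, h⟩) := fun i h => dif_pos h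
  have hee : ∀ i j : Fin n, i.val + 1 < j.val ∨ j.val + 1 < i.val →
      ⁅g (.e i), g (.e j)⁆ = 0 := fun i j hij => by
    have h := hg _ _ (Rel.ee i j hij)
    simp only [map_mul, FreeAlgebra.lift_ι_apply] at h
    rw [LieRing.of_associative_ring_bracket, h, sub_self]
  have hff : ∀ i j : Fin n, i.val + 1 < j.val ∨ j.val + 1 < i.val →
      ⁅g (.f i), g (.f j)⁆ = 0 := fun i j hij => by
    have h := hg _ _ (Rel.ff i j hij)
    simp only [map_mul, FreeAlgebra.lift_ι_apply] at h
    rw [LieRing.of_associative_ring_bracket, h, sub_self]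
  have hes : ∀ i j : Fin n, i.val + 1 = j.val ∨ j.val + 1 = i.val →
      ⁅g (.e i), ⁅g (.e i), g (.e j)⁆⁆ = 0 := fun i j hij => by
    have h := hg _ _ (Rel.eSerre i j hij)
    simp only [map_mul, map_add, map_sub, map_pow, map_ofNat, map_zero,
      FreeAlgebra.lift_ι_apply] at h
    rw [← serre_eq_lie_lie, h]
  have hfs : ∀ i j : Fin n, i.val + 1 = j.val ∨ j.val + 1 = i.val →
      ⁅g (.f i), ⁅g (.f i), g (.f j)⁆⁆ = 0 := fun i j hij => by
    have h := hg _ _ (Rel.fSerre i j hij)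
    simp only [map_mul, map_add, map_sub, map_pow, map_ofNat, map_zero,
      FreeAlgebra.lift_ι_apply] at h
    rw [← serre_eq_lie_lie, h]
  have hef : ∀ i j : Fin n, ¬(i.val + 1 = n ∧ j.val + 1 = n) → ⁅g (.e i), g (.f j)⁆ =
      delta (i.val + 1) (j.val + 1) • (g (.d i.castSucc) - g (.d i.succ)) := fun i j hij => by
    have h := hg _ _ (Rel.ef i j hij)
    simp only [map_mul, map_sub, map_smul, FreeAlgebra.lift_ι_apply] at h
    rw [LieRing.of_associative_ring_bracket, h]
  refine ⟨⟨fun a ha b hb => ?_, fun a ha j hj => ?_, fun a ha j hj => ?_, fun i j hi hj hij => ?_,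
    fun i j hij hj => ?_, fun i j hij hj => ?_, fun i hi => ?_, fun i hi => ?_, fun i hi => ?_,
    fun i hi => ?_⟩, fun i hi => ?_, fun i hi => ?_, fun i hi => ?_⟩
  · have h := hg _ _ (Rel.dd ⟨a, ha⟩ ⟨b, hb⟩)
    simp only [map_mul, FreeAlgebra.lift_ι_apply] at h
    rw [hd a ha, hd b hb, smul_lie, lie_smul, LieRing.of_associative_ring_bracket, h, sub_self,
      smul_zero, smul_zero]
  · have h := hg _ _ (Rel.de ⟨a, ha⟩ ⟨j, by omega⟩)
    simp only [map_mul, map_sub, map_smul, FreeAlgebra.lift_ι_apply] at h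
    rw [delta_eq (by omega) (by omega)] at h
    rw [hd a ha, he j (by omega), smul_lie, LieRing.of_associative_ring_bracket, h, smul_smul,
      half_mul_two]
    split_ifs <;> module
  · have h := hg _ _ (Rel.df ⟨a, ha⟩ ⟨j, by omega⟩)
    simp only [map_mul, map_sub, map_smul, FreeAlgebra.lift_ι_apply] at h
    rw [delta_eq' (by omega) (by omega)] at h
    rw [hd a ha, hf j (by omega), smul_lie, LieRing.of_associative_ring_bracket, h, smul_smul,
      half_mul_two]
    split_ifs <;> module
  · rw [he i (by omega), hf j (by omega), hef _ _ (by simp only; omega), delta,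
      if_neg (by simp only; omega), zero_smul]
  · rw [he i (by omega), he j (by omega), hee _ _ (Or.inl hij)]
  · rw [hf i (by omega), hf j (by omega), hff _ _ (Or.inl hij)]
  · rw [he i (by omega), he (i + 1) (by omega), hes _ _ (Or.inl rfl)]
  · rw [he i (by omega), he (i + 1) (by omega), hes _ _ (Or.inr rfl)]
  · rw [hf i (by omega), hf (i + 1) (by omega), hfs _ _ (Or.inl rfl)]
  · rw [hf i (by omega), hf (i + 1) (by omega), hfs _ _ (Or.inr rfl)]
  · rw [he i (by omega), hf i (by omega), hef _ _ (by simp only; omega), delta, if_pos rfl,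
      one_smul, dSeq_of_lt g (by omega), dSeq_of_lt g hi]
    rfl
  · have h := hg _ _ (Rel.efn ⟨i, by omega⟩ hi)
    simp only [map_mul, map_add, map_sub, map_pow, map_ofNat, map_neg,
      FreeAlgebra.lift_ι_apply] at h
    -- The sign of `-4` is absorbed by `⁅⁅x, y⁆, x⁆ = -⁅x, ⁅x, y⁆⁆`.
    rw [he i (by omega), hf i (by omega), ← lie_skew, ← serre_eq_lie_lie, h, neg_four_mul, neg_neg]
  · have h := hg _ _ (Rel.fen ⟨i, by omega⟩ hi)
    simp only [map_mul, map_add, map_sub, map_pow, map_ofNat, map_neg,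
      FreeAlgebra.lift_ι_apply] at h
    rw [he i (by omega), hf i (by omega), ← lie_skew, ← serre_eq_lie_lie, h, neg_four_mul, neg_neg]

/-- Elements which satisfy the Lie algebra version of the defining relations satisfy the defining
relations. -/
theorem IsFixedSerre.rel {g : Gen n → A} (hg : IsFixedSerre n (eSeq g) (fSeq g) (dSeq g))
    {x y : FreeAlgebra ℂ (Gen n)} (hxy : Rel n x y) :
    FreeAlgebra.lift ℂ g x = FreeAlgebra.lift ℂ g y := by
  have comm : ∀ {x y : A}, ⁅x, y⁆ = 0 → x * y = y * x := fun h => sub_eq_zero.1 h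
  have sub : ∀ x y : A, x * y - y * x = ⁅x, y⁆ := fun _ _ => rfl
  have skew : ∀ {x y : A}, ⁅x, y⁆ = 0 → ⁅y, x⁆ = 0 := fun {x y} h => by
    rw [← lie_skew, h, neg_zero]
  cases hxy with
  | dd a b =>
    simp only [map_mul, FreeAlgebra.lift_ι_apply, ← dSeq_val g]
    apply comm
    rw [smul_lie, lie_smul, hg.pre.dd a a.2 b b.2, smul_zero, smul_zero]
  | de a j =>
    simp only [map_mul, map_sub, map_smul, FreeAlgebra.lift_ι_apply, ← dSeq_val g,
      ← eSeq_val g, sub]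
    rw [smul_lie, hg.pre.de a a.2 j (by omega), delta_eq (by omega) (by omega), mul_smul]
    congr 1
    split_ifs <;> module
  | df a j =>
    simp only [map_mul, map_sub, map_smul, FreeAlgebra.lift_ι_apply, ← dSeq_val g,
      ← fSeq_val g, sub]
    rw [smul_lie, hg.pre.df a a.2 j (by omega), delta_eq' (by omega) (by omega), mul_smul]
    congr 1
    split_ifs <;> module
  | ef i j hij =>
    simp only [map_mul, map_sub, map_smul, FreeAlgebra.lift_ι_apply, ← eSeq_val g,
      ← fSeq_val g, sub]
    by_cases h : i = j
    · subst h
      have hi : i.val + 1 < n := by omega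
      rw [hg.ef_diag i hi, delta, if_pos rfl, one_smul, dSeq_of_lt g i.2, dSeq_of_lt g hi]
      rfl
    · have h' : i.val ≠ j.val := fun h' => h (Fin.ext h')
      rw [hg.pre.ef i j (by omega) (by omega) h', delta, if_neg (by omega), zero_smul]
  | eSerre i j hij =>
    simp only [map_mul, map_add, map_sub, map_pow, map_ofNat, map_zero, FreeAlgebra.lift_ι_apply]
    simp only [serre_eq_lie_lie, ← eSeq_val g]
    rcases hij with hij | hij <;> rw [← hij]
    · exact hg.pre.e_e_succ i (by omega)
    · exact hg.pre.e_succ_e j (by omega)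
  | fSerre i j hij =>
    simp only [map_mul, map_add, map_sub, map_pow, map_ofNat, map_zero, FreeAlgebra.lift_ι_apply]
    simp only [serre_eq_lie_lie, ← fSeq_val g]
    rcases hij with hij | hij <;> rw [← hij]
    · exact hg.pre.f_f_succ i (by omega)
    · exact hg.pre.f_succ_f j (by omega)
  | ee i j hij =>
    simp only [map_mul, FreeAlgebra.lift_ι_apply, ← eSeq_val g]
    apply comm
    rcases hij with hij | hij
    · exact hg.pre.ee i j hij (by omega)
    · exact skew (hg.pre.ee j i hij (by omega))
  | ff i j hij =>
    simp only [map_mul, FreeAlgebra.lift_ι_apply, ← fSeq_val g]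
    apply comm
    rcases hij with hij | hij
    · exact hg.pre.ff i j hij (by omega)
    · exact skew (hg.pre.ff j i hij (by omega))
  | efn i hi =>
    simp only [map_mul, map_add, map_sub, map_pow, map_ofNat, map_neg, FreeAlgebra.lift_ι_apply]
    simp only [serre_eq_lie_lie, ← eSeq_val g, ← fSeq_val g]
    rw [← lie_skew, hg.efe i hi, neg_four_mul]
  | fen i hi =>
    simp only [map_mul, map_add, map_sub, map_pow, map_ofNat, map_neg, FreeAlgebra.lift_ι_apply]
    simp only [serre_eq_lie_lie, ← eSeq_val g, ← fSeq_val g]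
    rw [← lie_skew, hg.fef i hi, neg_four_mul]

end Relations

/-! ### The isomorphism with `U(𝔤^θ)` -/

/-- The elements of `𝔤^θ` named by the symbols. -/
def genFix (n : ℕ) : Gen n → fixedSubalgebra n
  | .e i => eFix n i
  | .f i => fFix n i
  | .d a => dFix n a

theorem genVal_eq (n : ℕ) (x : Gen n) :
    genVal n x = UniversalEnvelopingAlgebra.ι ℂ (genFix n x) := by
  cases x <;> rfl

theorem blocks_eSeq (i : ℕ) : blocks n (eSeq (genFix n) i) = eBlocks n i := by
  by_cases h : i < n
  · rw [eSeq, dif_pos h]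
    exact blocks_eFix ⟨i, h⟩
  · rw [eSeq, dif_neg h, eBlocks, stdUnit_of_le_right (by omega), stdUnit_of_le_right (by omega)]
    exact map_zero _

theorem blocks_fSeq (i : ℕ) : blocks n (fSeq (genFix n) i) = fBlocks n i := by
  by_cases h : i < n
  · rw [fSeq, dif_pos h]
    exact blocks_fFix ⟨i, h⟩
  · rw [fSeq, dif_neg h, fBlocks, stdUnit_of_le_left (by omega), stdUnit_of_le_left (by omega),
      smul_zero]
    exact map_zero _

theorem blocks_dSeq (i : ℕ) : blocks n (dSeq (genFix n) i) = dBlocks n i := by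
  by_cases h : i < n + 1
  · rw [dSeq, dif_pos h, map_smul]
    refine (congrArg _ (blocks_dFix ⟨i, h⟩)).trans ?_
    rw [smul_smul]
    split_ifs <;> simp
  · rw [dSeq, dif_neg h, dBlocks, stdUnit_of_le_right (by omega), stdUnit_of_le_right (by omega)]
    exact map_zero _

theorem isFixedSerre_genFix (n : ℕ) :
    IsFixedSerre n (eSeq (genFix n)) (fSeq (genFix n)) (dSeq (genFix n)) := by
  refine IsFixedSerre.of_injective (blocks n) (blocks_injective n) ?_
  simp only [blocks_eSeq, blocks_fSeq, blocks_dSeq]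
  exact isFixedSerre_blocks n

theorem isFixedSerre_genVal (n : ℕ) :
    IsFixedSerre n (eSeq (genVal n)) (fSeq (genVal n)) (dSeq (genVal n)) := by
  let φ : fixedSubalgebra n →ₗ⁅ℂ⁆ Uj n := UniversalEnvelopingAlgebra.ι ℂ
  have h := (isFixedSerre_genFix n).map φ
  have hg : genVal n = fun x => (φ : fixedSubalgebra n →ₗ[ℂ] Uj n) (genFix n x) :=
    funext (genVal_eq n)
  have h1 : eSeq (genVal n) = fun i => φ (eSeq (genFix n) i) := by
    rw [hg]; exact funext (map_eSeq _ _)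
  have h2 : fSeq (genVal n) = fun i => φ (fSeq (genFix n) i) := by
    rw [hg]; exact funext (map_fSeq _ _)
  have h3 : dSeq (genVal n) = fun i => φ (dSeq (genFix n) i) := by
    rw [hg]; exact funext (map_dSeq _ _)
  rw [h1, h2, h3]
  exact h

/-- The symbols generate `𝔤^θ` as a Lie algebra. -/
theorem mem_of_genFix_mem (S : LieSubalgebra ℂ (fixedSubalgebra n)) (hS : ∀ x, genFix n x ∈ S)
    (x : fixedSubalgebra n) : x ∈ S := by
  have hmem := (isSplitting_blocks n).mem (S.map (blocks n))
    (fun i hi => ⟨_, hS (.e ⟨i, hi⟩), blocks_eFix _⟩)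
    (fun i hi => ⟨_, hS (.f ⟨i, hi⟩), blocks_fFix _⟩)
    (fun i hi => ⟨dSeq (genFix n) i, by
      rw [dSeq, dif_pos (by omega)]
      exact S.smul_mem _ (hS _), blocks_dSeq i⟩)
  obtain ⟨y, hy, hyx⟩ := mem_of_units _ hmem.1 hmem.2 (blocks n x)
  rwa [← blocks_injective n hyx]

/-- The equalizer of `φ` and `ψ` is a Lie subalgebra containing the generators. -/
theorem lieHom_ext_genFix {L : Type*} [LieRing L] [LieAlgebra ℂ L]
    {φ ψ : fixedSubalgebra n →ₗ⁅ℂ⁆ L} (h : ∀ x, φ (genFix n x) = ψ (genFix n x)) : φ = ψ := by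
  let S : LieSubalgebra ℂ (fixedSubalgebra n) :=
    { LinearMap.eqLocus (φ : fixedSubalgebra n →ₗ[ℂ] L) (ψ : fixedSubalgebra n →ₗ[ℂ] L) with
      lie_mem' := by
        intro x y hx hy
        change φ x = ψ x at hx
        change φ y = ψ y at hy
        change φ ⁅x, y⁆ = ψ ⁅x, y⁆
        rw [φ.map_lie, ψ.map_lie, hx, hy] }
  exact LieHom.ext fun x => mem_of_genFix_mem S h x

/-- The generators are expressed through the matrix units by the same formulas in `𝔤𝔩_{n+1} × 𝔤𝔩_n`
and in `L`, so the homomorphism sending units to `Q` and `R`, composed with `blocks`, has the right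
values. -/
theorem IsSplitting.exists_lieHom {L : Type*} [LieRing L] [LieAlgebra ℂ L] {Q R : ℕ → ℕ → L}
    {g : Gen n → L} (h : IsSplitting n Q R (eSeq g) (fSeq g) (dSeq g)) :
    ∃ φ : fixedSubalgebra n →ₗ⁅ℂ⁆ L, ∀ x, φ (genFix n x) = g x := by
  let σ := splitHom h.left h.right h.comm
  have hl : ∀ i < n + 1, ∀ j < n + 1, σ (leftUnit (n + 1) n i j) = Q i j := by
    intro i hi j hj
    simp only [σ, splitHom_apply, leftUnit, map_zero, add_zero, unitMap_stdUnit Q hi hj]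
  have hr : ∀ i < n, ∀ j < n, σ (rightUnit (n + 1) n i j) = R i j := by
    intro i hi j hj
    simp only [σ, splitHom_apply, rightUnit, map_zero, zero_add, unitMap_stdUnit R hi hj]
  have hb := isSplitting_blocks n
  refine ⟨σ.comp (blocks n), fun x => ?_⟩
  rw [LieHom.comp_apply]
  cases x with
  | e i =>
    rw [genFix, blocks_eFix, ← eSeq_val g]
    by_cases hi : i.val + 1 < n
    · rw [hb.upper i hi, h.upper i hi, map_add, hl _ (by omega) _ (by omega), hr _ i.2 _ hi]
    · rw [hb.upper_last i (by omega), h.upper_last i (by omega), hl _ (by omega) _ (by omega)]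
  | f i =>
    rw [genFix, blocks_fFix, ← fSeq_val g]
    by_cases hi : i.val + 1 < n
    · rw [hb.lower i hi, h.lower i hi, map_add, hl _ (by omega) _ (by omega), hr _ hi _ i.2]
    · rw [hb.lower_last i (by omega), h.lower_last i (by omega), map_smul,
        hl _ (by omega) _ (by omega)]
  | d a =>
    rw [genFix, blocks_dFix, ← dSeq_val g, map_smul]
    congr 1
    by_cases ha : a.val < n
    · rw [hb.diag a ha, h.diag a ha, map_add, hl _ (by omega) _ (by omega), hr _ ha _ ha]
    · rw [show a.val = n by omega, hb.diag_last, h.diag_last, hl _ (by omega) _ (by omega)]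

theorem lift_presGen (n : ℕ) :
    FreeAlgebra.lift ℂ (presGen n) = RingQuot.mkAlgHom ℂ (Rel n) := by
  refine FreeAlgebra.hom_ext (funext fun x => ?_)
  simp only [Function.comp_apply, FreeAlgebra.lift_ι_apply]
  rfl

theorem adjoin_range_presGen (n : ℕ) : Algebra.adjoin ℂ (Set.range (presGen n)) = ⊤ := by
  have h : Set.range (presGen n) =
      RingQuot.mkAlgHom ℂ (Rel n) '' Set.range (FreeAlgebra.ι ℂ) := by
    rw [← Set.range_comp]
    rfl
  rw [h, ← AlgHom.map_adjoin, FreeAlgebra.adjoin_range_ι, Algebra.map_top,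
    AlgHom.range_eq_top]
  exact RingQuot.mkAlgHom_surjective ℂ (Rel n)

/-- The homomorphism from the presented algebra to `U(𝔤^θ)`. -/
def presHom (n : ℕ) : Presented n →ₐ[ℂ] Uj n :=
  RingQuot.liftAlgHom ℂ ⟨FreeAlgebra.lift ℂ (genVal n), fun _ _ h => (isFixedSerre_genVal n).rel h⟩

theorem presHom_presGen (x : Gen n) : presHom n (presGen n x) = genVal n x := by
  rw [presHom, presGen, RingQuot.liftAlgHom_mkAlgHom_apply, FreeAlgebra.lift_ι_apply]

theorem exists_presEquiv (n : ℕ) :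
    ∃ Φ : Presented n ≃ₐ[ℂ] Uj n, ∀ x : Gen n, Φ (presGen n x) = genVal n x := by
  have h := isFixedSerre_of_rel (n := n) (g := presGen n) fun x y hxy => by
    rw [lift_presGen]
    exact RingQuot.mkAlgHom_rel ℂ hxy
  -- The splitting is carried out inside the presented algebra, regarded as a Lie algebra under the
  -- commutator.
  obtain ⟨Q, R, hQR⟩ := h.pre.exists_isSplitting h.ef_diag h.efe h.fef
  obtain ⟨ψ, hψ⟩ := hQR.exists_lieHom
  have hψ' : ∀ x, UniversalEnvelopingAlgebra.lift ℂ ψ (genVal n x) = presGen n x := by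
    intro x
    rw [genVal_eq, UniversalEnvelopingAlgebra.lift_ι_apply, hψ]
  refine ⟨AlgEquiv.ofAlgHom (presHom n) (UniversalEnvelopingAlgebra.lift ℂ ψ) ?_ ?_,
    presHom_presGen⟩
  · refine UniversalEnvelopingAlgebra.hom_ext ℂ (lieHom_ext_genFix fun x => ?_)
    change presHom n (UniversalEnvelopingAlgebra.lift ℂ ψ (UniversalEnvelopingAlgebra.ι ℂ _)) =
      UniversalEnvelopingAlgebra.ι ℂ (genFix n x)
    rw [← genVal_eq, hψ', presHom_presGen]
  · refine RingQuot.ringQuot_ext' ℂ _ _ (FreeAlgebra.hom_ext (funext fun x => ?_))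
    change UniversalEnvelopingAlgebra.lift ℂ ψ (presHom n (presGen n x)) = presGen n x
    rw [presHom_presGen, hψ']

end Presentation

end FixedPointGL

end

theorem mainTheorem2 (n : ℕ) :
    Algebra.adjoin ℂ (Set.range (FixedPointGL.genVal n)) = ⊤ ∧
    ∃ Φ : FixedPointGL.Presented n ≃ₐ[ℂ] FixedPointGL.Uj n,
      ∀ x : FixedPointGL.Gen n, Φ (FixedPointGL.presGen n x) = FixedPointGL.genVal n x := by
  obtain ⟨Φ, hΦ⟩ := FixedPointGL.exists_presEquiv n
  refine ⟨?_, Φ, hΦ⟩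
  have h : Set.range (FixedPointGL.genVal n) =
      (Φ : FixedPointGL.Presented n →ₐ[ℂ] FixedPointGL.Uj n) ''
        Set.range (FixedPointGL.presGen n) := by
    rw [← Set.range_comp]
    exact congrArg Set.range (funext fun x => (hΦ x).symm)
  rw [h, ← AlgHom.map_adjoin, FixedPointGL.adjoin_range_presGen, Algebra.map_top,
    AlgHom.range_eq_top]
  exact Φ.surjective
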